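/- Let $E=(E^0,E^1,r,s)$ be a directed graph with countably many vertices and edges ($s(e)$ and $r(e)$ are the source and range of the edge $e$), let $R$ be a field, and let $L_R(E)$ be the Leavitt path algebra, i.e. the universal (not necessarily unital) $R$-algebra generated by pairwise orthogonal idempotents $v$ ($v\in E^0$) and elements $e,e^*$ ($e\in E^1$) with $s(e)e=e\,r(e)=e$, $r(e)e^*=e^*s(e)=e^*$, $e^*f=\delta_{e,f}r(e)$ for all $e,f\in E^1$, and $v=\sum_{s(e)=v}ee^*$ whenever $0<|s^{-1}(v)|<\infty$. Write $v\ge w$ if there is a path (possibly of length zero) from $v$ to $w$. A closed path based at $v$ is a path $e_1\cdots e_n$, $n\ge1$, from $v$ to $v$; it is a closed simple path if $s(e_i)\ne s(e_1)$ for all $i>1$. Assume that $E$ satisfies Condition (K): every vertex is either the base of no closed path or the base of at least two distinct closed simple paths. A maximal tail is a nonempty set $M\subseteq E^0$ such that: (MT1) if $v\ge w$ and $w\in M$, then $v\in M$; (MT2) if $v\in M$ and $0<|s^{-1}(v)|<\infty$, then $r(e)\in M$ for some $e$ with $s(e)=v$; (MT3) for all $v,w\in M$ there is $y\in M$ with $v\ge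 y$ and $w\ge y$. Let $M(E)$ be the set of maximal tails. For $X\subseteq E^0$ let $\Omega(X)=\{w\in E^0\setminus X: w\not\ge v\text{ for every }v\in X\}$, and $\Omega(v)=\Omega(\{v\})$. For $H\subseteq E^0$ let $$B_H=\{v\in E^0\setminus H: |s^{-1}(v)|=\infty\text{ and }0<|s^{-1}(v)\cap r^{-1}(E^0\setminus H)|<\infty\},$$ put $v^H=v-\sum_{s(e)=v,\ r(e)\notin H}ee^*$ for $v\in B_H$, and for $S\subseteq B_H$ let $I(H,S)$ be the two-sided ideal of $L_R(E)$ generated by $\{v:v\in H\}\cup\{v^H:v\in S\}$. Let $BV(E)$ be the set of vertices $v$ with $|s^{-1}(v)|=\infty$ and $v\in B_{\Omega(v)}$. A two-sided ideal $I$ is left (right) primitive if the ring $L_R(E)/I$ has a faithful simple left (right) module, where a module $N$ over a ring $A$ is simple if $AN\neq0$ (respectively $NA\ne 0$) and its only submodules are $0$ and $N$; it is prime if it is proper and, for two-sided ideals $J_1,J_2$, $J_1J_2\subseteq I$ implies $J_1\subseteq I$ or $J_2\subseteq I$. Then the set of left primitive ideals of $L_R(E)$ and the set of right primitive ideals of $L_R(E)$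 are both equal to $$\{I(\Omega(M),B_{\Omega(M)}): M\in M(E)\}\cup\{I(\Omega(v),B_{\Omega(v)}\setminus\{v\}): v\in BV(E)\}.$$ In particular, the set of prime ideals of $L_R(E)$ coincides with the set of left primitive ideals and with the set of right primitive ideals. -/

import Mathlib

universe u v w x

/-- A directed graph `(V, Ed, r, s)`: vertices `V`, edges `Ed`, source map `s`, range map `r`.
Loops and multiple edges are allowed. -/
structure DirGraph (V : Type u) (Ed : Type v) where
  s : Ed → V
  r : Ed → V

namespace DirGraph

variable {V : Type u} {Ed : Type v} (E : DirGraph V Ed)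

/-- The set `s⁻¹(v)` of edges emitted by `v`. -/
def out (a : V) : Set Ed := {e | E.s e = a}

/-- `E.IsPath a α b`: the list of edges `α` is a path with source `a` and range `b`.
The empty list is the path of length zero at a vertex. -/
def IsPath : V → List Ed → V → Prop
  | a, [], b => a = b
  | a, e :: α, b => E.s e = a ∧ IsPath (E.r e) α b

/-- `a ≥ b`: there is a path from `a` to `b`. -/
def Ge (a b : V) : Prop := ∃ α : List Ed, E.IsPath a α b

/-- `α` is a closed path based at `a` (of positive length). -/
def IsClosedPath (a : V) (α : List Ed) : Prop := α ≠ [] ∧ E.IsPath a α a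

/-- `α = e₁ … eₙ` is a closed simple path based at `a`: a closed path based at `a = s(e₁)` with
`s(eᵢ) ≠ s(e₁)` for every `i > 1`. -/
def IsClosedSimplePath (a : V) (α : List Ed) : Prop :=
  E.IsClosedPath a α ∧ ∀ e ∈ α.tail, E.s e ≠ a

/-- Condition (K): every vertex is either the base of no closed path or the base of at least two
distinct closed simple paths. -/
def ConditionK : Prop :=
  ∀ a : V, (¬ ∃ α, E.IsClosedPath a α) ∨
    ∃ α β, α ≠ β ∧ E.IsClosedSimplePath a α ∧ E.IsClosedSimplePath a β

/-- `B_H`: the vertices outside `H` that emit infinitely many edges, of which a finite nonzero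
number have range outside `H`. -/
def B (H : Set V) : Set V :=
  {a | a ∉ H ∧ (E.out a).Infinite ∧
    {e | E.s e = a ∧ E.r e ∉ H}.Nonempty ∧ {e | E.s e = a ∧ E.r e ∉ H}.Finite}

/-- `Ω(X)`: the vertices outside `X` from which no vertex of `X` can be reached. -/
def Omega (X : Set V) : Set V := {b | b ∉ X ∧ ∀ a ∈ X, ¬ E.Ge b a}

/-- Maximal tails. -/
structure IsMaximalTail (M : Set V) : Prop where
  nonempty : M.Nonempty
  mt1 : ∀ a b, b ∈ M → E.Ge a b → a ∈ M
  mt2 : ∀ a ∈ M, (E.out a).Nonempty → (E.out a).Finite → ∃ e, E.s e = a ∧ E.r e ∈ M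
  mt3 : ∀ a ∈ M, ∀ b ∈ M, ∃ y ∈ M, E.Ge a y ∧ E.Ge b y

/-- `BV(E)`: the breaking vertices, i.e. the infinite emitters `a` with `a ∈ B_{Ω(a)}`. -/
def BV : Set V := {a | (E.out a).Infinite ∧ a ∈ E.B (E.Omega {a})}

/-- A Leavitt `E`-family in a (not necessarily unital) ring `A`: the images `p` of the vertices,
`q` of the edges and `q'` of the ghost edges. -/
structure IsLeavittFamily {A : Type x} [NonUnitalRing A]
    (p : V → A) (q q' : Ed → A) : Prop where
  idem : ∀ a, p a * p a = p a
  orth : ∀ a b, a ≠ b → p a * p b = 0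
  source_edge : ∀ e, p (E.s e) * q e = q e
  edge_range : ∀ e, q e * p (E.r e) = q e
  range_ghost : ∀ e, p (E.r e) * q' e = q' e
  ghost_source : ∀ e, q' e * p (E.s e) = q' e
  ghost_edge : ∀ e, q' e * q e = p (E.r e)
  ghost_edge_ne : ∀ e f, e ≠ f → q' e * q f = 0
  vertex_sum : ∀ a (h : (E.out a).Finite), (E.out a).Nonempty →
    p a = ∑ e ∈ h.toFinset, q e * q' e

end DirGraph

namespace LPA

/-- The generating symbols `v`, `e`, `e*`. -/
inductive Gen (V : Type u) (Ed : Type v) : Type (max u v)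
  | vertex (a : V)
  | edge (e : Ed)
  | ghost (e : Ed)

/-- The free associative non-unital `R`-algebra on the symbols `v`, `e`, `e*`. -/
abbrev Free (R : Type w) [CommRing R] (V : Type u) (Ed : Type v) : Type (max u v w) :=
  MonoidAlgebra R (FreeSemigroup (Gen V Ed))

/-- A generating symbol as an element of the free algebra. -/
noncomputable def gen (R : Type w) [CommRing R] {V : Type u} {Ed : Type v} (g : Gen V Ed) :
    Free R V Ed :=
  MonoidAlgebra.single (FreeSemigroup.of g) 1

open Gen in
/-- The defining relations of a Leavitt `E`-family, in the free algebra. -/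
inductive Rel (R : Type w) [CommRing R] {V : Type u} {Ed : Type v} (E : DirGraph V Ed) :
    Free R V Ed → Free R V Ed → Prop
  | idem (a : V) : Rel R E (gen R (vertex a) * gen R (vertex a)) (gen R (vertex a))
  | orth (a b : V) (h : a ≠ b) : Rel R E (gen R (vertex a) * gen R (vertex b)) 0
  | source_edge (e : Ed) : Rel R E (gen R (vertex (E.s e)) * gen R (edge e)) (gen R (edge e))
  | edge_range (e : Ed) : Rel R E (gen R (edge e) * gen R (vertex (E.r e))) (gen R (edge e))
  | range_ghost (e : Ed) : Rel R E (gen R (vertex (E.r e)) * gen R (ghost e)) (gen R (ghost e))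
  | ghost_source (e : Ed) : Rel R E (gen R (ghost e) * gen R (vertex (E.s e))) (gen R (ghost e))
  | ghost_edge (e : Ed) : Rel R E (gen R (ghost e) * gen R (edge e)) (gen R (vertex (E.r e)))
  | ghost_edge_ne (e f : Ed) (h : e ≠ f) : Rel R E (gen R (ghost e) * gen R (edge f)) 0
  | vertex_sum (a : V) (h : (E.out a).Finite) (hne : (E.out a).Nonempty) :
      Rel R E (gen R (vertex a)) (∑ e ∈ h.toFinset, gen R (edge e) * gen R (ghost e))

/-- The `R`-algebra congruence generated by the Leavitt relations. All scalar multiples of the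
relations are included because the free algebra has no unit. -/
noncomputable def con (R : Type w) [CommRing R] {V : Type u} {Ed : Type v} (E : DirGraph V Ed) :
    RingCon (Free R V Ed) :=
  ringConGen fun y z => ∃ (c : R) (a b : Free R V Ed), Rel R E a b ∧ y = c • a ∧ z = c • b

theorem con_smul {R : Type w} [CommRing R] {V : Type u} {Ed : Type v} (E : DirGraph V Ed)
    (c : R) {y z : Free R V Ed} (h : con R E y z) : con R E (c • y) (c • z) := by
  have h' : RingConGen.Rel _ y z := h
  change RingConGen.Rel _ _ _
  induction h' with
  | of _ _ h' =>
    obtain ⟨d, a, b, hab, rfl, rfl⟩ := h'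
    exact .of _ _ ⟨c * d, a, b, hab, by rw [mul_smul], by rw [mul_smul]⟩
  | refl => exact .refl _
  | symm _ ih => exact .symm (ih ‹_›)
  | trans _ _ ih₁ ih₂ => exact .trans (ih₁ ‹_›) (ih₂ ‹_›)
  | add _ _ ih₁ ih₂ =>
    rw [smul_add, smul_add]
    exact .add (ih₁ ‹_›) (ih₂ ‹_›)
  | mul _ h₂ ih₁ _ =>
    rw [← smul_mul_assoc, ← smul_mul_assoc]
    exact .mul (ih₁ ‹_›) h₂

end LPA

/-- The Leavitt path algebra `L_R(E)`: the universal (not necessarily unital) `R`-algebra generated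
by a Leavitt `E`-family. -/
def LeavittPathAlgebra (R : Type w) [CommRing R] {V : Type u} {Ed : Type v} (E : DirGraph V Ed) :
    Type (max u v w) :=
  (LPA.con R E).Quotient

namespace LeavittPathAlgebra

variable (R : Type w) [CommRing R] {V : Type u} {Ed : Type v} (E : DirGraph V Ed)

noncomputable instance : NonUnitalRing (LeavittPathAlgebra R E) :=
  inferInstanceAs (NonUnitalRing (LPA.con R E).Quotient)

/-- The quotient map from the free algebra. -/
noncomputable def mk : LPA.Free R V Ed →ₙ+* LeavittPathAlgebra R E where
  toFun a := (LPA.con R E).toQuotient a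
  map_mul' _ _ := rfl
  map_zero' := rfl
  map_add' _ _ := rfl

theorem mk_surjective : Function.Surjective (mk R E) := Quotient.mk''_surjective

noncomputable instance : SMul R (LeavittPathAlgebra R E) where
  smul c := Quotient.map' (c • ·) fun _ _ h => LPA.con_smul E c h

theorem mk_smul (c : R) (a : LPA.Free R V Ed) : mk R E (c • a) = c • mk R E a := rfl

noncomputable instance : Module R (LeavittPathAlgebra R E) :=
  Function.Surjective.module R (mk R E).toAddMonoidHom (mk_surjective R E) (mk_smul R E)

instance : IsScalarTower R (LeavittPathAlgebra R E) (LeavittPathAlgebra R E) where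
  smul_assoc c a b := by
    obtain ⟨a, rfl⟩ := mk_surjective R E a
    obtain ⟨b, rfl⟩ := mk_surjective R E b
    simp only [smul_eq_mul, ← mk_smul, ← map_mul, smul_mul_assoc]

instance : SMulCommClass R (LeavittPathAlgebra R E) (LeavittPathAlgebra R E) where
  smul_comm c a b := by
    obtain ⟨a, rfl⟩ := mk_surjective R E a
    obtain ⟨b, rfl⟩ := mk_surjective R E b
    simp only [smul_eq_mul, ← mk_smul, ← map_mul, mul_smul_comm]

/-- The vertex `a` as an element of `L_R(E)`. -/
noncomputable def vert (a : V) : LeavittPathAlgebra R E := mk R E (LPA.gen R (.vertex a))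

/-- The edge `e` as an element of `L_R(E)`. -/
noncomputable def edge (e : Ed) : LeavittPathAlgebra R E := mk R E (LPA.gen R (.edge e))

/-- The ghost edge `e*` as an element of `L_R(E)`. -/
noncomputable def ghost (e : Ed) : LeavittPathAlgebra R E := mk R E (LPA.gen R (.ghost e))

theorem mk_eq_of_rel {a b : LPA.Free R V Ed} (h : LPA.Rel R E a b) : mk R E a = mk R E b :=
  Quotient.sound' <| RingConGen.Rel.of _ _ ⟨1, a, b, h, (one_smul _ _).symm, (one_smul _ _).symm⟩

/-- The generators of `L_R(E)` form a Leavitt `E`-family. -/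
theorem isLeavittFamily : E.IsLeavittFamily (vert R E) (edge R E) (ghost R E) where
  idem a := by simpa using! mk_eq_of_rel R E (.idem a)
  orth a b h := by simpa using! mk_eq_of_rel R E (.orth a b h)
  source_edge e := by simpa using! mk_eq_of_rel R E (.source_edge e)
  edge_range e := by simpa using! mk_eq_of_rel R E (.edge_range e)
  range_ghost e := by simpa using! mk_eq_of_rel R E (.range_ghost e)
  ghost_source e := by simpa using! mk_eq_of_rel R E (.ghost_source e)
  ghost_edge e := by simpa using! mk_eq_of_rel R E (.ghost_edge e)
  ghost_edge_ne e f h := by simpa using! mk_eq_of_rel R E (.ghost_edge_ne e f h)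
  vertex_sum a h hne := by
    have := mk_eq_of_rel R E (.vertex_sum a h hne)
    rw [map_sum] at this
    simpa only [map_mul] using! this

variable {R E} in
/-- Homomorphisms out of `L_R(E)` are determined by the generators. -/
theorem hom_ext {A : Type x} [NonUnitalRing A] [Module R A] [IsScalarTower R A A]
    [SMulCommClass R A A] {φ ψ : LeavittPathAlgebra R E →ₙₐ[R] A}
    (hv : ∀ a, φ (vert R E a) = ψ (vert R E a)) (he : ∀ e, φ (edge R E e) = ψ (edge R E e))
    (hg : ∀ e, φ (ghost R E e) = ψ (ghost R E e)) : φ = ψ := by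
  let π : LPA.Free R V Ed →ₙₐ[R] LeavittPathAlgebra R E :=
    { mk R E with map_smul' := mk_smul R E }
  have key : φ.comp π = ψ.comp π := by
    apply (MonoidAlgebra.liftMagma R).symm.injective
    apply FreeSemigroup.hom_ext
    funext g
    cases g with
    | vertex a => exact hv a
    | edge e => exact he e
    | ghost e => exact hg e
  ext y
  obtain ⟨y, rfl⟩ := mk_surjective R E y
  exact DFunLike.congr_fun key y

variable {R E} in
/-- The universal property of `L_R(E)`. -/
theorem exists_hom {A : Type x} [NonUnitalRing A] [Module R A] [IsScalarTower R A A]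
    [SMulCommClass R A A] {p : V → A} {q q' : Ed → A} (h : E.IsLeavittFamily p q q') :
    ∃ φ : LeavittPathAlgebra R E →ₙₐ[R] A, (∀ a, φ (vert R E a) = p a) ∧
      (∀ e, φ (edge R E e) = q e) ∧ ∀ e, φ (ghost R E e) = q' e := by
  let F : LPA.Free R V Ed →ₙₐ[R] A :=
    MonoidAlgebra.liftMagma R (FreeSemigroup.lift (fun g : LPA.Gen V Ed => match g with
      | .vertex a => p a
      | .edge e => q e
      | .ghost e => q' e))
  have Fv (a : V) : F (LPA.gen R (.vertex a)) = p a := by simp [F, LPA.gen]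
  have Fe (e : Ed) : F (LPA.gen R (.edge e)) = q e := by simp [F, LPA.gen]
  have Fg (e : Ed) : F (LPA.gen R (.ghost e)) = q' e := by simp [F, LPA.gen]
  have hrel : ∀ a b, LPA.Rel R E a b → F a = F b := by
    intro a b hab
    cases hab with
    | idem a => simp [Fv, h.idem]
    | orth a b hne => simp [Fv, h.orth a b hne]
    | source_edge e => simp [Fv, Fe, h.source_edge]
    | edge_range e => simp [Fv, Fe, h.edge_range]
    | range_ghost e => simp [Fv, Fg, h.range_ghost]
    | ghost_source e => simp [Fv, Fg, h.ghost_source]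
    | ghost_edge e => simp [Fv, Fe, Fg, h.ghost_edge]
    | ghost_edge_ne e f hne => simp [Fe, Fg, h.ghost_edge_ne e f hne]
    | vertex_sum a hf hne => simp [Fv, Fe, Fg, h.vertex_sum a hf hne, map_sum]
  have hcon : ∀ y z, LPA.con R E y z → F y = F z := by
    intro y z hyz
    have h' : RingConGen.Rel _ y z := hyz
    clear hyz
    induction h' with
    | of _ _ h' =>
      obtain ⟨d, a, b, hab, rfl, rfl⟩ := h'
      rw [map_smul, map_smul, hrel a b hab]
    | refl => rfl
    | symm _ ih => exact ih.symm
    | trans _ _ ih₁ ih₂ => exact ih₁.trans ih₂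
    | add _ _ ih₁ ih₂ => rw [map_add, map_add, ih₁, ih₂]
    | mul _ _ ih₁ ih₂ => rw [map_mul, map_mul, ih₁, ih₂]
  let f : LeavittPathAlgebra R E → A := fun y => Quotient.liftOn' y F hcon
  have hf : ∀ y, f (mk R E y) = F y := fun _ => rfl
  refine ⟨{ toFun := f, map_smul' := ?_, map_zero' := ?_, map_add' := ?_, map_mul' := ?_ },
    Fv, Fe, Fg⟩
  · intro c y
    obtain ⟨y, rfl⟩ := mk_surjective R E y
    rw [← mk_smul, hf, hf, map_smul]; rfl
  · rw [← map_zero (mk R E), hf, map_zero]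
  · intro y z
    obtain ⟨y, rfl⟩ := mk_surjective R E y
    obtain ⟨z, rfl⟩ := mk_surjective R E z
    rw [← map_add, hf, hf, hf, map_add]
  · intro y z
    obtain ⟨y, rfl⟩ := mk_surjective R E y
    obtain ⟨z, rfl⟩ := mk_surjective R E z
    rw [← map_mul, hf, hf, hf, map_mul]

/-- The element `v^H = v - ∑ e e*`, the (finite, if `v ∈ B_H`) sum being over the edges `e` with
`s(e) = v` and `r(e) ∉ H`. -/
noncomputable def vertH (H : Set V) (a : V) : LeavittPathAlgebra R E :=
  vert R E a - ∑ᶠ e ∈ {e | E.s e = a ∧ E.r e ∉ H}, edge R E e * ghost R E e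

/-- `I(H, S)`: the two-sided ideal generated by `{v : v ∈ H} ∪ {v^H : v ∈ S}`. -/
noncomputable def idealHS (H S : Set V) : TwoSidedIdeal (LeavittPathAlgebra R E) :=
  TwoSidedIdeal.span (vert R E '' H ∪ vertH R E H '' S)

end LeavittPathAlgebra

/-- A (not necessarily unital) ring `A` is left primitive if it has a faithful simple left module:
an abelian group `M` with an action `ρ` of `A` such that `A M ≠ 0`, the only submodules are `0` and
`M`, and only `0 ∈ A` annihilates `M`. A simple module is a quotient of `A` as a module, so nothing
is lost by taking `M` in the universe of `A`. -/
def IsLeftPrimitiveRing (A : Type u) [NonUnitalRing A] : Prop :=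
  ∃ (M : Type u) (_ : AddCommGroup M) (ρ : A →ₙ+* AddMonoid.End M),
    (∃ a, ρ a ≠ 0) ∧
    (∀ N : AddSubgroup M, (∀ a, ∀ m ∈ N, ρ a m ∈ N) → N = ⊥ ∨ N = ⊤) ∧
    ∀ a, ρ a = 0 → a = 0

/-- `A` is right primitive if it has a faithful simple right module, i.e. if the opposite ring is
left primitive. -/
def IsRightPrimitiveRing (A : Type u) [NonUnitalRing A] : Prop :=
  IsLeftPrimitiveRing Aᵐᵒᵖ

namespace TwoSidedIdeal

variable {A : Type u} [NonUnitalRing A] (I : TwoSidedIdeal A)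

/-- `I` is a left primitive ideal: the ring `A/I` is left primitive. -/
def IsLeftPrimitiveIdeal : Prop := IsLeftPrimitiveRing I.ringCon.Quotient

/-- `I` is a right primitive ideal: the ring `A/I` is right primitive. -/
def IsRightPrimitiveIdeal : Prop := IsRightPrimitiveRing I.ringCon.Quotient

/-- `I` is a prime ideal: it is proper, and `J₁ J₂ ⊆ I` implies `J₁ ⊆ I` or `J₂ ⊆ I` for all
two-sided ideals `J₁`, `J₂`. -/
def IsPrimeIdeal : Prop :=
  I ≠ ⊤ ∧ ∀ J₁ J₂ : TwoSidedIdeal A, (∀ a ∈ J₁, ∀ b ∈ J₂, a * b ∈ I) → J₁ ≤ I ∨ J₂ ≤ I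

end TwoSidedIdeal

namespace LeavittPathAlgebra

/-- The set of ideals `I(Ω(M), B_{Ω(M)})`, `M` a maximal tail, and `I(Ω(v), B_{Ω(v)} \ {v})`,
`v` a breaking vertex. -/
def tailIdeals (R : Type w) [CommRing R] {V : Type u} {Ed : Type v} (E : DirGraph V Ed) :
    Set (TwoSidedIdeal (LeavittPathAlgebra R E)) :=
  {I | (∃ M : Set V, E.IsMaximalTail M ∧ I = idealHS R E (E.Omega M) (E.B (E.Omega M))) ∨
    ∃ a ∈ E.BV, I = idealHS R E (E.Omega {a}) (E.B (E.Omega {a}) \ {a})}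

end LeavittPathAlgebra

/-! The sets of prime, left primitive and right primitive ideals are compared through the inclusions
primitive ⊆ prime ⊆ `tailIdeals` ⊆ primitive. The first is general ring theory.

For the second, the decisive fact is `eq_idealHS`: under Condition (K) an ideal I is determined by H
= `vertexSet I` and the set of those a ∈ B_H with a^H ∈ I. It is proved by induction on the length
of ghost paths; the base case turns a combination of paths in I into a vertex in I by conjugating
with a path δ that kills all closed paths present (`ConditionK.exists_avoiding`). If I is prime, the
complement of H is a maximal tail. Modulo I each a^H behaves like a sink, so two different gap
elements annihilate each other through the algebra and at most one a^H lies outside I. In that case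
every vertex outside H connects to a, so H = Ω(a) and a is a breaking vertex.

For the third, each tail ideal is realised as the kernel of a simple module whose basis is a set of
paths (`BranchingSystem`): either the finite paths into one vertex that is a sink or an infinite
emitter, or a tail class of infinite paths. Simplicity is a support-reduction argument, and the
kernel is read off from `eq_idealHS`. Countability of the vertex set produces the infinite path.
Interchanging edges and ghost edges turns the same spaces into right modules. -/

namespace DirGraph

/-! ### Paths, closed simple paths and Condition (K). -/

variable {V : Type u} {Ed : Type v} {E : DirGraph V Ed}

theorem isPath_append {a b : V} {α β : List Ed} :
    E.IsPath a (α ++ β) b ↔ ∃ c, E.IsPath a α c ∧ E.IsPath c β b := by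
  induction α generalizing a with
  | nil => simp [IsPath]
  | cons e α ih => simp [IsPath, ih, and_assoc]

theorem IsPath.append {a b c : V} {α β : List Ed} (h : E.IsPath a α b) (h' : E.IsPath b β c) :
    E.IsPath a (α ++ β) c :=
  isPath_append.2 ⟨b, h, h'⟩

theorem IsPath.range_unique {a b c : V} {α : List Ed} (h : E.IsPath a α b)
    (h' : E.IsPath a α c) : b = c := by
  induction α generalizing a with
  | nil => exact h.symm.trans h'
  | cons e α ih => exact ih h.2 h'.2

theorem isPath_singleton (e : Ed) : E.IsPath (E.s e) [e] (E.r e) := ⟨rfl, rfl⟩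

theorem Ge.refl (a : V) : E.Ge a a := ⟨[], rfl⟩

theorem Ge.trans {a b c : V} : E.Ge a b → E.Ge b c → E.Ge a c := by
  rintro ⟨α, h⟩ ⟨β, h'⟩
  exact ⟨α ++ β, h.append h'⟩

theorem ge_edge (e : Ed) : E.Ge (E.s e) (E.r e) := ⟨[e], isPath_singleton e⟩

/-- A closed path that is comparable with a closed simple path extends it. -/
theorem IsClosedSimplePath.prefix_of {a : V} {μ γ : List Ed} (hμ : E.IsClosedSimplePath a μ)
    (hγ : E.IsClosedPath a γ) (h : μ <+: γ ∨ γ <+: μ) : μ <+: γ := by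
  rcases h with h | ⟨β, rfl⟩
  · exact h
  · rcases β with _ | ⟨e, β⟩
    · simp
    -- If γ were a proper initial segment of μ, the edge of μ right after γ would start at a, which
    -- closed simple paths forbid.
    · obtain ⟨c, h1, h2⟩ := isPath_append.1 hμ.1.2
      obtain rfl := h1.range_unique hγ.2
      refine absurd h2.1 (hμ.2 e ?_)
      obtain ⟨f, γ, rfl⟩ := List.exists_cons_of_ne_nil hγ.1
      simp

theorem isPath_iterate {a : V} {μ ν : List Ed} (hμ : E.IsPath a μ a) (hν : E.IsPath a ν a)
    (k : ℕ) : E.IsPath a ((μ ++ ·)^[k] ν) a := by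
  induction k with
  | zero => exact hν
  | succ k ih =>
    rw [Function.iterate_succ_apply']
    exact hμ.append ih

/-- Here `(μ ++ ·)^[k] ν` is the path μᵏν. Cancelling μᵏ would make ν comparable with μ, and
comparable closed simple paths at the same vertex are equal. -/
theorem not_iterate_prefix_iterate {a : V} {μ ν : List Ed} (hμ : E.IsClosedSimplePath a μ)
    (hν : E.IsClosedSimplePath a ν) (hne : μ ≠ ν) (k m : ℕ) (hkm : k < m) :
    ¬ (μ ++ ·)^[k] ν <+: (μ ++ ·)^[m] ν := by
  induction k generalizing m with
  | zero =>
    intro h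
    obtain ⟨m, rfl⟩ := Nat.exists_eq_succ_of_ne_zero hkm.ne'
    rw [Function.iterate_succ_apply'] at h
    have h1 := List.prefix_or_prefix_of_prefix (List.prefix_append μ ((μ ++ ·)^[m] ν)) h
    have h2 := hμ.prefix_of hν.1 h1
    have h3 := hν.prefix_of hμ.1 h1.symm
    exact hne (h2.eq_of_length (le_antisymm h2.length_le h3.length_le))
  | succ k ih =>
    obtain ⟨m, rfl⟩ := Nat.exists_eq_succ_of_ne_zero (Nat.ne_zero_of_lt hkm)
    simp only [Function.iterate_succ_apply', List.prefix_append_right_inj]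
    exact ih m (by omega)

/-- If γ is nonempty, then μ is comparable with γ and hence begins it; cancelling μ lowers k by one
and shortens γ by at least one edge. The three numerical hypotheses are chosen to survive this
cancellation, until γ is empty and the previous lemma applies. -/
theorem not_iterate_prefix_append {a : V} {μ ν : List Ed} (hμ : E.IsClosedSimplePath a μ)
    (hν : E.IsClosedSimplePath a ν) (hne : μ ≠ ν) (k m : ℕ) (γ : List Ed) (hγ : E.IsPath a γ a)
    (hkm : k ≤ m) (hnil : γ = [] → k < m) (hlen : γ.length ≤ k) :
    ¬ (μ ++ ·)^[k] ν <+: γ ++ (μ ++ ·)^[m] ν := by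
  induction k generalizing γ with
  | zero =>
    obtain rfl := List.length_eq_zero_iff.1 (Nat.le_zero.1 hlen)
    exact not_iterate_prefix_iterate hμ hν hne _ _ (hnil rfl)
  | succ k ih =>
    by_cases h0 : γ = []
    · subst h0
      exact not_iterate_prefix_iterate hμ hν hne _ _ (hnil rfl)
    intro h
    have h1 : μ <+: γ := by
      refine hμ.prefix_of ⟨h0, hγ⟩ 
        (List.prefix_or_prefix_of_prefix ?_ (List.prefix_append γ ((μ ++ ·)^[m] ν)))
      refine List.IsPrefix.trans ?_ h
      rw [Function.iterate_succ_apply']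
      exact List.prefix_append _ _
    obtain ⟨γ, rfl⟩ := h1
    rw [Function.iterate_succ_apply', List.append_assoc, List.prefix_append_right_inj] at h
    obtain ⟨c, h2, h3⟩ := isPath_append.1 hγ
    obtain rfl := h2.range_unique hμ.1.2
    have : 0 < μ.length := List.length_pos_iff.2 hμ.1.1
    rw [List.length_append] at hlen
    exact ih γ h3 (by omega) (fun _ => by omega) (by omega) h

/-- Under Condition (K), finitely many closed paths `γ` at `a` can be simultaneously avoided by a
path `δ` from `a` to `a`, in the sense that `δ` is not an initial segment of `γδ`. -/
theorem ConditionK.exists_avoiding (hK : E.ConditionK) (a : V) (Γ : Finset (List Ed))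
    (hΓ : ∀ γ ∈ Γ, E.IsClosedPath a γ) :
    ∃ δ, E.IsPath a δ a ∧ ∀ γ ∈ Γ, ¬ δ <+: γ ++ δ := by
  rcases hK a with h | ⟨μ, ν, hne, hμ, hν⟩
  · exact ⟨[], rfl, fun γ hγ => (h ⟨γ, hΓ γ hγ⟩).elim⟩
  -- The exponent is the largest length in Γ, so the length condition holds for all γ at once.
  · refine ⟨(μ ++ ·)^[Γ.sup List.length] ν, isPath_iterate hμ.1.2 hν.1.2 _, fun γ hγ => ?_⟩
    exact not_iterate_prefix_append hμ hν hne _ _ γ (hΓ γ hγ).2 le_rfl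
      (fun h => ((hΓ γ hγ).1 h).elim) (Finset.le_sup (f := List.length) hγ)

end DirGraph

/-! ### Generation of L_R(E) and products of generators. -/

namespace LeavittPathAlgebra

open DirGraph

variable {R : Type w} [CommRing R] {V : Type u} {Ed : Type v} {E : DirGraph V Ed}

/-- The universal property gives a map into S whose composite with the inclusion fixes the
generators, hence is the identity. This serves as the induction principle for elements of L_R(E). -/
theorem subalgebra_eq_top (S : NonUnitalSubalgebra R (LeavittPathAlgebra R E))
    (hv : ∀ a, vert R E a ∈ S) (he : ∀ e, edge R E e ∈ S) (hg : ∀ e, ghost R E e ∈ S) :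
    S = ⊤ := by
  have h := isLeavittFamily R E
  have hS : E.IsLeavittFamily (A := S) (fun a => ⟨_, hv a⟩) (fun e => ⟨_, he e⟩)
      (fun e => ⟨_, hg e⟩) :=
    { idem := fun a => Subtype.ext (h.idem a)
      orth := fun a b hab => Subtype.ext (h.orth a b hab)
      source_edge := fun e => Subtype.ext (h.source_edge e)
      edge_range := fun e => Subtype.ext (h.edge_range e)
      range_ghost := fun e => Subtype.ext (h.range_ghost e)
      ghost_source := fun e => Subtype.ext (h.ghost_source e)
      ghost_edge := fun e => Subtype.ext (h.ghost_edge e)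
      ghost_edge_ne := fun e f hef => Subtype.ext (h.ghost_edge_ne e f hef)
      vertex_sum := fun a hf hne => Subtype.ext <| by
        have := h.vertex_sum a hf hne
        simpa using! this }
  obtain ⟨φ, h1, h2, h3⟩ := exists_hom (R := R) hS
  have : (NonUnitalSubalgebraClass.subtype S).comp φ = NonUnitalAlgHom.id R _ :=
    hom_ext (fun a => by simp [h1]) (fun e => by simp [h2]) (fun e => by simp [h3])
  refine eq_top_iff.2 fun y _ => ?_
  have hy := DFunLike.congr_fun this y
  have hy' : ((φ y : S) : LeavittPathAlgebra R E) = y := hy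
  exact hy' ▸ (φ y).2

theorem vert_mul_vert [DecidableEq V] (a b : V) :
    vert R E a * vert R E b = if a = b then vert R E a else 0 := by
  split_ifs with h
  · subst h
    exact (isLeavittFamily R E).idem a
  · exact (isLeavittFamily R E).orth a b h

theorem edge_mul_vert [DecidableEq V] (e : Ed) (b : V) :
    edge R E e * vert R E b = if E.r e = b then edge R E e else 0 := by
  rw [← (isLeavittFamily R E).edge_range e, mul_assoc, vert_mul_vert]
  split_ifs <;> simp

theorem vert_mul_edge [DecidableEq V] (e : Ed) (b : V) :
    vert R E b * edge R E e = if E.s e = b then edge R E e else 0 := by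
  rw [← (isLeavittFamily R E).source_edge e, ← mul_assoc, vert_mul_vert]
  by_cases h : b = E.s e
  · simp [h]
  · simp [h, Ne.symm h]

theorem ghost_mul_vert [DecidableEq V] (e : Ed) (b : V) :
    ghost R E e * vert R E b = if E.s e = b then ghost R E e else 0 := by
  rw [← (isLeavittFamily R E).ghost_source e, mul_assoc, vert_mul_vert]
  split_ifs <;> simp

theorem ghost_mul_edge [DecidableEq Ed] (e f : Ed) :
    ghost R E e * edge R E f = if e = f then vert R E (E.r e) else 0 := by
  split_ifs with h
  · subst h
    exact (isLeavittFamily R E).ghost_edge e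
  · exact (isLeavittFamily R E).ghost_edge_ne e f h

/-! ### Local units. -/

section LocalUnits

/-- The sums of finitely many vertices are local units. -/
theorem sum_vert_mul_sum_vert [DecidableEq V] {F G : Finset V} (h : F ⊆ G) :
    (∑ a ∈ F, vert R E a) * ∑ a ∈ G, vert R E a = ∑ a ∈ F, vert R E a := by
  rw [Finset.sum_mul_sum]
  refine Finset.sum_congr rfl fun a ha => ?_
  simp [vert_mul_vert, h ha]

theorem sum_vert_mul_sum_vert' [DecidableEq V] {F G : Finset V} (h : F ⊆ G) :
    (∑ a ∈ G, vert R E a) * ∑ a ∈ F, vert R E a = ∑ a ∈ F, vert R E a := by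
  rw [Finset.sum_mul_sum, Finset.sum_comm]
  refine Finset.sum_congr rfl fun a ha => ?_
  simp [vert_mul_vert, h ha]

theorem exists_right_unit (x : LeavittPathAlgebra R E) :
    ∃ F : Finset V, x * ∑ a ∈ F, vert R E a = x := by
  classical
  let S : NonUnitalSubalgebra R (LeavittPathAlgebra R E) :=
    { carrier := {x | ∃ F : Finset V, x * ∑ a ∈ F, vert R E a = x}
      zero_mem' := ⟨∅, by simp⟩
      add_mem' := by
        rintro x y ⟨F, hF⟩ ⟨G, hG⟩
        refine ⟨F ∪ G, ?_⟩
        rw [add_mul]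
        conv_lhs => rw [← hF, ← hG, mul_assoc, mul_assoc,
          sum_vert_mul_sum_vert Finset.subset_union_left,
          sum_vert_mul_sum_vert Finset.subset_union_right, hF, hG]
      mul_mem' := by
        rintro x y - ⟨G, hG⟩
        exact ⟨G, by rw [mul_assoc, hG]⟩
      smul_mem' := by
        rintro c x ⟨F, hF⟩
        exact ⟨F, by rw [smul_mul_assoc, hF]⟩ }
  have : S = ⊤ := subalgebra_eq_top S (fun a => ⟨{a}, by simp [vert_mul_vert]⟩)
    (fun e => ⟨{E.r e}, by simp [edge_mul_vert]⟩) (fun e => ⟨{E.s e}, by simp [ghost_mul_vert]⟩)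
  have hx : x ∈ S := this ▸ trivial
  exact hx

theorem exists_left_unit (x : LeavittPathAlgebra R E) :
    ∃ F : Finset V, (∑ a ∈ F, vert R E a) * x = x := by
  classical
  let S : NonUnitalSubalgebra R (LeavittPathAlgebra R E) :=
    { carrier := {x | ∃ F : Finset V, (∑ a ∈ F, vert R E a) * x = x}
      zero_mem' := ⟨∅, by simp⟩
      add_mem' := by
        rintro x y ⟨F, hF⟩ ⟨G, hG⟩
        refine ⟨F ∪ G, ?_⟩
        rw [mul_add]
        conv_lhs => rw [← hF, ← hG, ← mul_assoc, ← mul_assoc,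
          sum_vert_mul_sum_vert' Finset.subset_union_left,
          sum_vert_mul_sum_vert' Finset.subset_union_right, hF, hG]
      mul_mem' := by
        rintro x y ⟨G, hG⟩ -
        exact ⟨G, by rw [← mul_assoc, hG]⟩
      smul_mem' := by
        rintro c x ⟨F, hF⟩
        exact ⟨F, by rw [mul_smul_comm, hF]⟩ }
  have : S = ⊤ := subalgebra_eq_top S (fun a => ⟨{a}, by simp [vert_mul_vert]⟩)
    (fun e => ⟨{E.s e}, by simp [vert_mul_edge]⟩)
    (fun e => ⟨{E.r e}, by simp [(isLeavittFamily R E).range_ghost]⟩)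
  have hx : x ∈ S := this ▸ trivial
  exact hx

/-- A `TwoSidedIdeal` is only closed under ring multiplication; with a local unit u for x, the
scalar moves into it: c • x = x(c • u). -/
theorem smul_mem_ideal (I : TwoSidedIdeal (LeavittPathAlgebra R E)) (c : R)
    {x : LeavittPathAlgebra R E} (hx : x ∈ I) : c • x ∈ I := by
  obtain ⟨F, hF⟩ := exists_right_unit x
  rw [← hF, ← mul_smul_comm]
  exact I.mul_mem_right _ _ hx

theorem mem_of_forall_mul_vert (I : TwoSidedIdeal (LeavittPathAlgebra R E))
    {x : LeavittPathAlgebra R E} (h : ∀ a, x * vert R E a ∈ I) : x ∈ I := by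
  obtain ⟨F, hF⟩ := exists_right_unit x
  rw [← hF, Finset.mul_sum]
  exact sum_mem fun a _ => h a

theorem eq_top_of_forall_vert_mem (I : TwoSidedIdeal (LeavittPathAlgebra R E))
    (h : ∀ a, vert R E a ∈ I) : I = ⊤ :=
  eq_top_iff.2 fun _ _ => mem_of_forall_mul_vert I fun a => I.mul_mem_left _ _ (h a)

end LocalUnits

/-! ### Paths and ghost paths as elements of L_R(E). -/

section Paths

variable (R E)

/-- The element of `L_R(E)` given by a path with range `b`. -/
noncomputable def path (α : List Ed) (b : V) : LeavittPathAlgebra R E :=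
  α.foldr (fun e x => edge R E e * x) (vert R E b)

/-- The element `α*` of `L_R(E)` for a path `α` with range `b`. -/
noncomputable def ghostPath (α : List Ed) (b : V) : LeavittPathAlgebra R E :=
  α.foldr (fun e x => x * ghost R E e) (vert R E b)

variable {R E}

@[simp] theorem path_nil (b : V) : path R E [] b = vert R E b := rfl

@[simp] theorem ghostPath_nil (b : V) : ghostPath R E [] b = vert R E b := rfl

theorem path_cons (e : Ed) (α : List Ed) (b : V) :
    path R E (e :: α) b = edge R E e * path R E α b := rfl

theorem ghostPath_cons (e : Ed) (α : List Ed) (b : V) :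
    ghostPath R E (e :: α) b = ghostPath R E α b * ghost R E e := rfl

theorem path_mul_vert_self (α : List Ed) (b : V) :
    path R E α b * vert R E b = path R E α b := by
  induction α with
  | nil => exact (isLeavittFamily R E).idem b
  | cons e α ih => rw [path_cons, mul_assoc, ih]

theorem path_mul_vert_of_ne (α : List Ed) {b c : V} (h : b ≠ c) :
    path R E α b * vert R E c = 0 := by
  rw [← path_mul_vert_self, mul_assoc, (isLeavittFamily R E).orth b c h, mul_zero]

theorem vert_mul_path {a b : V} {α : List Ed} (h : E.IsPath a α b) :
    vert R E a * path R E α b = path R E α b := by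
  cases α with
  | nil =>
    cases h
    exact (isLeavittFamily R E).idem _
  | cons e α =>
    obtain ⟨rfl, -⟩ := h
    rw [path_cons, ← mul_assoc, (isLeavittFamily R E).source_edge]

theorem path_eq_zero {α : List Ed} {b : V} (h : ¬ ∃ a, E.IsPath a α b) : path R E α b = 0 := by
  induction α with
  | nil => exact (h ⟨b, rfl⟩).elim
  | cons e α ih =>
    by_cases h' : ∃ a, E.IsPath a α b
    · obtain ⟨a, ha⟩ := h'
      have hne : E.r e ≠ a := by
        rintro rfl
        exact h ⟨_, rfl, ha⟩
      rw [path_cons, ← vert_mul_path ha, ← (isLeavittFamily R E).edge_range, mul_assoc,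
        ← mul_assoc (vert R E _), (isLeavittFamily R E).orth _ _ hne, zero_mul, mul_zero]
    · rw [path_cons, ih h', mul_zero]

theorem ghostPath_eq_zero {α : List Ed} {b : V} (h : ¬ ∃ a, E.IsPath a α b) :
    ghostPath R E α b = 0 := by
  classical
  have key : ∀ (α : List Ed) a, E.IsPath a α b →
      ghostPath R E α b * vert R E a = ghostPath R E α b := by
    intro α a h
    cases α with
    | nil =>
      cases h
      exact (isLeavittFamily R E).idem _
    | cons e α =>
      obtain ⟨rfl, -⟩ := h
      rw [ghostPath_cons, mul_assoc, (isLeavittFamily R E).ghost_source]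
  induction α with
  | nil => exact (h ⟨b, rfl⟩).elim
  | cons e α ih =>
    by_cases h' : ∃ a, E.IsPath a α b
    · obtain ⟨a, ha⟩ := h'
      have hne : a ≠ E.r e := by
        rintro rfl
        exact h ⟨_, rfl, ha⟩
      rw [ghostPath_cons, ← key α a ha, ← (isLeavittFamily R E).range_ghost, mul_assoc,
        ← mul_assoc (vert R E _), (isLeavittFamily R E).orth _ _ hne, zero_mul, mul_zero]
    · rw [ghostPath_cons, ih h', zero_mul]

theorem ghostPath_mul_path_append {a b c : V} {α β : List Ed} (hα : E.IsPath a α b)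
    (hβ : E.IsPath b β c) :
    ghostPath R E α b * path R E (α ++ β) c = path R E β c := by
  induction α generalizing a with
  | nil => exact vert_mul_path hβ
  | cons e α ih =>
    rw [ghostPath_cons, List.cons_append, path_cons, mul_assoc, ← mul_assoc (ghost R E e),
      (isLeavittFamily R E).ghost_edge, vert_mul_path (hα.2.append hβ), ih hα.2]

theorem ghostPath_mul_path_self {a b : V} {α : List Ed} (hα : E.IsPath a α b) :
    ghostPath R E α b * path R E α b = vert R E b := by
  simpa using ghostPath_mul_path_append (R := R) hα (β := []) rfl

theorem path_mul_path {b c : V} {α β : List Ed} (hβ : E.IsPath b β c) :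
    path R E α b * path R E β c = path R E (α ++ β) c := by
  induction α with
  | nil => exact vert_mul_path hβ
  | cons e α ih => rw [path_cons, mul_assoc, ih, List.cons_append, path_cons]

theorem ghostPath_mul_path_of_not_prefix {a b c d : V} {α β : List Ed} (hα : E.IsPath a α b)
    (hβ : E.IsPath c β d) (hlen : α.length ≤ β.length) (h : ¬ α <+: β) :
    ghostPath R E α b * path R E β d = 0 := by
  induction α generalizing β a c with
  | nil => simp at h
  | cons e α ih =>
    cases β with
    | nil => simp at hlen
    | cons f β =>
      rw [ghostPath_cons, path_cons, mul_assoc, ← mul_assoc (ghost R E e)]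
      by_cases hef : e = f
      · subst hef
        rw [(isLeavittFamily R E).ghost_edge, vert_mul_path hβ.2]
        refine ih hα.2 hβ.2 (by simpa using hlen) fun h' => h ?_
        simpa using h'
      · rw [(isLeavittFamily R E).ghost_edge_ne e f hef, zero_mul, mul_zero]

end Paths

/-! ### Spanning by monomials αβ*, filtered by the length of β. -/

section Spanning

variable (R E)

/-- The span of the monomials `αβ*` with `β` of length at most `n`. -/
noncomputable def ghostDegreeLE (n : ℕ) : Submodule R (LeavittPathAlgebra R E) :=
  Submodule.span R {x | ∃ α β b, β.length ≤ n ∧ x = path R E α b * ghostPath R E β b}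

variable {R E}

theorem ghostDegreeLE_mono {m n : ℕ} (h : m ≤ n) : ghostDegreeLE R E m ≤ ghostDegreeLE R E n := by
  refine Submodule.span_mono ?_
  rintro _ ⟨α, β, b, hβ, rfl⟩
  exact ⟨α, β, b, hβ.trans h, rfl⟩

theorem path_mul_ghostPath_mem (α : List Ed) {β : List Ed} (b : V) {n : ℕ} (h : β.length ≤ n) :
    path R E α b * ghostPath R E β b ∈ ghostDegreeLE R E n :=
  Submodule.subset_span ⟨α, β, b, h, rfl⟩

theorem path_mem (α : List Ed) (b : V) (n : ℕ) : path R E α b ∈ ghostDegreeLE R E n := by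
  have h := path_mul_ghostPath_mem (R := R) (E := E) α (β := []) b (Nat.zero_le n)
  rwa [ghostPath_nil, path_mul_vert_self] at h

theorem ghostDegreeLE_mul_vert {n : ℕ} {x : LeavittPathAlgebra R E}
    (hx : x ∈ ghostDegreeLE R E n) (a : V) : x * vert R E a ∈ ghostDegreeLE R E n := by
  classical
  induction hx using Submodule.span_induction with
  | mem x hx =>
    obtain ⟨α, β, b, hβ, rfl⟩ := hx
    rw [mul_assoc]
    have h : ghostPath R E β b * vert R E a = 0 ∨
        ghostPath R E β b * vert R E a = ghostPath R E β b := by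
      cases β with
      | nil =>
        rw [ghostPath_nil, vert_mul_vert]
        split_ifs <;> simp
      | cons e β =>
        rw [ghostPath_cons, mul_assoc, ghost_mul_vert]
        split_ifs <;> simp
    rcases h with h | h <;> rw [h]
    · rw [mul_zero]
      exact zero_mem _
    · exact path_mul_ghostPath_mem _ _ hβ
  | zero =>
    rw [zero_mul]
    exact zero_mem _
  | add x y _ _ hx hy =>
    rw [add_mul]
    exact add_mem hx hy
  | smul c x _ hx =>
    rw [smul_mul_assoc]
    exact Submodule.smul_mem _ c hx

theorem ghostDegreeLE_mul_ghost {n : ℕ} {x : LeavittPathAlgebra R E}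
    (hx : x ∈ ghostDegreeLE R E n) (e : Ed) : x * ghost R E e ∈ ghostDegreeLE R E (n + 1) := by
  induction hx using Submodule.span_induction with
  | mem x hx =>
    obtain ⟨α, β, b, hβ, rfl⟩ := hx
    rw [mul_assoc, ← ghostPath_cons]
    exact path_mul_ghostPath_mem _ _ (by simpa using hβ)
  | zero =>
    rw [zero_mul]
    exact zero_mem _
  | add x y _ _ hx hy =>
    rw [add_mul]
    exact add_mem hx hy
  | smul c x _ hx =>
    rw [smul_mul_assoc]
    exact Submodule.smul_mem _ c hx

theorem path_mul_edge (α : List Ed) (b : V) (e : Ed) :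
    path R E α b * edge R E e = 0 ∨
      path R E α b * edge R E e = path R E (α ++ [e]) (E.r e) := by
  by_cases h : b = E.s e
  · subst h
    right
    rw [← path_mul_path (isPath_singleton e), path_cons, path_nil,
      (isLeavittFamily R E).edge_range]
  · left
    rw [← (isLeavittFamily R E).source_edge, ← mul_assoc, path_mul_vert_of_ne _ h, zero_mul]

theorem ghostDegreeLE_mul_edge {n : ℕ} {x : LeavittPathAlgebra R E}
    (hx : x ∈ ghostDegreeLE R E n) (e : Ed) : x * edge R E e ∈ ghostDegreeLE R E (n - 1) := by
  classical
  induction hx using Submodule.span_induction with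
  | mem x hx =>
    obtain ⟨α, β, b, hβ, rfl⟩ := hx
    cases β with
    | nil =>
      rw [ghostPath_nil, path_mul_vert_self]
      rcases path_mul_edge (R := R) (E := E) α b e with h | h <;> rw [h]
      · exact zero_mem _
      · exact path_mem _ _ _
    | cons f β =>
      rw [ghostPath_cons, mul_assoc, mul_assoc, ghost_mul_edge]
      split_ifs
      · rw [← mul_assoc]
        refine ghostDegreeLE_mul_vert ?_ _
        refine path_mul_ghostPath_mem _ _ ?_
        rw [List.length_cons] at hβ
        omega
      · rw [mul_zero, mul_zero]
        exact zero_mem _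
  | zero =>
    rw [zero_mul]
    exact zero_mem _
  | add x y _ _ hx hy =>
    rw [add_mul]
    exact add_mem hx hy
  | smul c x _ hx =>
    rw [smul_mul_assoc]
    exact Submodule.smul_mem _ c hx

/-- The monomials `αβ*` span `L_R(E)`. -/
theorem exists_mem_ghostDegreeLE (x : LeavittPathAlgebra R E) : ∃ n, x ∈ ghostDegreeLE R E n := by
  -- S consists of the elements whose right multiplication preserves the union of the filtration.
  -- This condition passes to products, so the generators suffice; applying it to a left unit of x,
  -- which has degree 0, reaches x.
  let S : NonUnitalSubalgebra R (LeavittPathAlgebra R E) :=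
    { carrier := {x | ∀ (y : LeavittPathAlgebra R E) (n : ℕ), y ∈ ghostDegreeLE R E n →
        ∃ m, y * x ∈ ghostDegreeLE R E m}
      zero_mem' := fun y n _ => ⟨0, by simp⟩
      add_mem' := by
        intro x x' hx hx' y n hy
        obtain ⟨m, hm⟩ := hx y n hy
        obtain ⟨m', hm'⟩ := hx' y n hy
        refine ⟨max m m', ?_⟩
        rw [mul_add]
        exact add_mem (ghostDegreeLE_mono (le_max_left _ _) hm)
          (ghostDegreeLE_mono (le_max_right _ _) hm')
      mul_mem' := by
        intro x x' hx hx' y n hy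
        obtain ⟨m, hm⟩ := hx y n hy
        rw [← mul_assoc]
        exact hx' _ _ hm
      smul_mem' := by
        intro c x hx y n hy
        obtain ⟨m, hm⟩ := hx y n hy
        refine ⟨m, ?_⟩
        rw [mul_smul_comm]
        exact Submodule.smul_mem _ c hm }
  have hS : S = ⊤ := subalgebra_eq_top S (fun a y n hy => ⟨n, ghostDegreeLE_mul_vert hy a⟩)
    (fun e y n hy => ⟨_, ghostDegreeLE_mul_edge hy e⟩)
    (fun e y n hy => ⟨_, ghostDegreeLE_mul_ghost hy e⟩)
  have hx : x ∈ S := hS ▸ trivial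
  obtain ⟨F, hF⟩ := exists_left_unit x
  rw [← hF]
  refine hx _ 0 (sum_mem fun a _ => path_mem [] a 0)

/-- A subset closed under addition that contains the scalar multiples of `αβ*` is everything. -/
theorem monomial_induction {p : LeavittPathAlgebra R E → Prop} (x : LeavittPathAlgebra R E)
    (zero : p 0) (add : ∀ x y, p x → p y → p (x + y)) (smul : ∀ (c : R) x, p x → p (c • x))
    (mem : ∀ a b c α β, E.IsPath a α b → E.IsPath c β b →
      p (path R E α b * ghostPath R E β b)) : p x := by
  obtain ⟨n, hn⟩ := exists_mem_ghostDegreeLE x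
  induction hn using Submodule.span_induction with
  | mem x hx =>
    obtain ⟨α, β, b, -, rfl⟩ := hx
    by_cases h : ∃ a, E.IsPath a α b
    · by_cases h' : ∃ a, E.IsPath a β b
      · obtain ⟨a, ha⟩ := h
        obtain ⟨c, hc⟩ := h'
        exact mem a b c α β ha hc
      · rwa [ghostPath_eq_zero h', mul_zero]
    · rwa [path_eq_zero h, zero_mul]
  | zero => exact zero
  | add x y _ _ hx hy => exact add x y hx hy
  | smul c x _ hx => exact smul c x hx

/-- The first edge of β is the rightmost factor of β*, so it can be split off whenever β is
nonempty. No degree bound on y is needed: the later induction works with x * e, whose degree has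
dropped. -/
theorem exists_of_mem_ghostDegreeLE_succ {n : ℕ} {x : LeavittPathAlgebra R E}
    (hx : x ∈ ghostDegreeLE R E (n + 1)) :
    ∃ x₀ ∈ ghostDegreeLE R E 0, ∃ (F : Finset Ed) (y : Ed → LeavittPathAlgebra R E),
      x = x₀ + ∑ e ∈ F, y e * ghost R E e := by
  have hle : ghostDegreeLE R E (n + 1) ≤ ghostDegreeLE R E 0 ⊔
      ⨆ e : Ed, LinearMap.range (LinearMap.mulRight R (ghost R E e)) := by
    refine Submodule.span_le.2 ?_
    rintro _ ⟨α, β, b, -, rfl⟩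
    cases β with
    | nil => exact Submodule.mem_sup_left (path_mul_ghostPath_mem _ _ le_rfl)
    | cons e β =>
      refine Submodule.mem_sup_right
        (Submodule.mem_iSup_of_mem e ⟨path R E α b * ghostPath R E β b, ?_⟩)
      rw [ghostPath_cons, LinearMap.mulRight_apply, mul_assoc]
  obtain ⟨x₀, hx₀, z, hz, rfl⟩ := Submodule.mem_sup.1 (hle hx)
  obtain ⟨f, hf, rfl⟩ := (Submodule.mem_iSup_iff_exists_finsupp _ _).1 hz
  choose y hy using hf
  refine ⟨x₀, hx₀, f.support, y, ?_⟩
  congr 1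
  exact Finset.sum_congr rfl fun e _ => (hy e).symm

theorem mul_vert_mem_span {x : LeavittPathAlgebra R E} (hx : x ∈ ghostDegreeLE R E 0) (b : V) :
    x * vert R E b ∈
      Submodule.span R ((fun α => path R E α b) '' {α | ∃ a, E.IsPath a α b}) := by
  induction hx using Submodule.span_induction with
  | mem x hx =>
    obtain ⟨α, β, c, hβ, rfl⟩ := hx
    obtain rfl := List.length_eq_zero_iff.1 (Nat.le_zero.1 hβ)
    rw [ghostPath_nil, path_mul_vert_self]
    by_cases h : c = b
    · subst h
      rw [path_mul_vert_self]
      by_cases h : ∃ a, E.IsPath a α c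
      · exact Submodule.subset_span ⟨α, h, rfl⟩
      · rw [path_eq_zero h]
        exact zero_mem _
    · rw [path_mul_vert_of_ne _ h]
      exact zero_mem _
  | zero =>
    rw [zero_mul]
    exact zero_mem _
  | add x y _ _ hx hy =>
    rw [add_mul]
    exact add_mem hx hy
  | smul c x _ hx =>
    rw [smul_mul_assoc]
    exact Submodule.smul_mem _ c hx

end Spanning

end LeavittPathAlgebra

namespace LeavittPathAlgebra

open DirGraph

/-! ### The elements a^H. -/

section GapVertices

variable {R : Type w} [CommRing R] {V : Type u} {Ed : Type v} {E : DirGraph V Ed}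

theorem vertH_eq {H : Set V} {a : V} (h : {e | E.s e = a ∧ E.r e ∉ H}.Finite) :
    vertH R E H a = vert R E a - ∑ e ∈ h.toFinset, edge R E e * ghost R E e := by
  rw [vertH, finsum_mem_eq_finite_toFinset_sum _ h]

/-- Since f*e = 0 for f ≠ e, subtracting the projections ff* from a removes exactly the edges that
leave H's complement invariantly, i.e. those with range outside H. -/
theorem vertH_mul_edge {H : Set V} {a : V} (h : {e | E.s e = a ∧ E.r e ∉ H}.Finite) {e : Ed}
    (he : E.s e = a) [Decidable (E.r e ∈ H)] :
    vertH R E H a * edge R E e = if E.r e ∈ H then edge R E e else 0 := by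
  classical
  subst he
  have h1 : ∀ f ∈ h.toFinset, edge R E f * ghost R E f * edge R E e =
      if f = e then edge R E e else 0 := by
    intro f _
    rw [mul_assoc, ghost_mul_edge]
    split_ifs with hf
    · subst hf
      exact (isLeavittFamily R E).edge_range _
    · rw [mul_zero]
  rw [vertH_eq h, sub_mul, (isLeavittFamily R E).source_edge, Finset.sum_mul,
    Finset.sum_congr rfl h1, Finset.sum_ite_eq']
  by_cases hr : E.r e ∈ H <;> simp [hr]

theorem ghost_mul_vertH {H : Set V} {a : V} (h : {e | E.s e = a ∧ E.r e ∉ H}.Finite) {e : Ed}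
    (he : E.s e = a) [Decidable (E.r e ∈ H)] :
    ghost R E e * vertH R E H a = if E.r e ∈ H then ghost R E e else 0 := by
  classical
  subst he
  have h1 : ∀ f ∈ h.toFinset, ghost R E e * (edge R E f * ghost R E f) =
      if e = f then ghost R E e else 0 := by
    intro f _
    rw [← mul_assoc, ghost_mul_edge]
    split_ifs with hf
    · subst hf
      exact (isLeavittFamily R E).range_ghost _
    · rw [zero_mul]
  rw [vertH_eq h, mul_sub, (isLeavittFamily R E).ghost_source, Finset.mul_sum,
    Finset.sum_congr rfl h1, Finset.sum_ite_eq]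
  by_cases hr : E.r e ∈ H <;> simp [hr]

theorem vert_mul_vertH {H : Set V} {a : V} (h : {e | E.s e = a ∧ E.r e ∉ H}.Finite) :
    vert R E a * vertH R E H a = vertH R E H a := by
  rw [vertH_eq h, mul_sub, (isLeavittFamily R E).idem, Finset.mul_sum]
  congr 1
  refine Finset.sum_congr rfl fun e he => ?_
  obtain ⟨rfl, -⟩ := h.mem_toFinset.1 he
  rw [← mul_assoc, (isLeavittFamily R E).source_edge]

theorem vertH_mul_vert {H : Set V} {a : V} (h : {e | E.s e = a ∧ E.r e ∉ H}.Finite) :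
    vertH R E H a * vert R E a = vertH R E H a := by
  rw [vertH_eq h, sub_mul, (isLeavittFamily R E).idem, Finset.sum_mul]
  congr 1
  refine Finset.sum_congr rfl fun e he => ?_
  obtain ⟨rfl, -⟩ := h.mem_toFinset.1 he
  rw [mul_assoc, (isLeavittFamily R E).ghost_source]

theorem vertH_mul_vertH {H : Set V} {a : V} (h : {e | E.s e = a ∧ E.r e ∉ H}.Finite) :
    vertH R E H a * vertH R E H a = vertH R E H a := by
  classical
  conv_lhs => enter [1]; rw [vertH_eq (R := R) h]
  rw [sub_mul, vert_mul_vertH h, Finset.sum_mul, Finset.sum_eq_zero, sub_zero]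
  intro e he
  obtain ⟨hs, hr⟩ := h.mem_toFinset.1 he
  rw [mul_assoc, ghost_mul_vertH h hs, if_neg hr, mul_zero]

theorem vertH_mul_path_cons {H : Set V} {a b : V}
    (h : {e | E.s e = a ∧ E.r e ∉ H}.Finite) {e : Ed} {α : List Ed}
    (hr : E.r e ∉ H) : vertH R E H a * path R E (e :: α) b = 0 := by
  classical
  by_cases hs : E.s e = a
  · rw [path_cons, ← mul_assoc, vertH_mul_edge h hs, if_neg hr, zero_mul]
  · rw [path_cons, ← mul_assoc, ← vertH_mul_vert h, mul_assoc (vertH R E H a), vert_mul_edge,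
      if_neg hs, mul_zero, zero_mul]

end GapVertices

/-! ### Vertices and gap elements in an ideal. -/

section IdealInvariants

variable {R : Type w} [CommRing R] {V : Type u} {Ed : Type v} {E : DirGraph V Ed}

/-- The vertices in an ideal. -/
def vertexSet (I : TwoSidedIdeal (LeavittPathAlgebra R E)) : Set V := {a | vert R E a ∈ I}

/-- The breaking vertices `a` of `H = vertexSet I` for which `a^H` lies in `I`. -/
def gapSet (I : TwoSidedIdeal (LeavittPathAlgebra R E)) : Set V :=
  {a | a ∈ E.B (vertexSet I) ∧ vertH R E (vertexSet I) a ∈ I}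

variable {I : TwoSidedIdeal (LeavittPathAlgebra R E)}

theorem idealHS_le (I : TwoSidedIdeal (LeavittPathAlgebra R E)) :
    idealHS R E (vertexSet I) (gapSet I) ≤ I := by
  refine TwoSidedIdeal.span_le.2 ?_
  rintro _ (⟨a, ha, rfl⟩ | ⟨a, ha, rfl⟩)
  · exact ha
  · exact ha.2

theorem vert_mem_idealHS {H S : Set V} {a : V} (h : a ∈ H) : vert R E a ∈ idealHS R E H S :=
  TwoSidedIdeal.subset_span (Or.inl ⟨a, h, rfl⟩)

theorem vertH_mem_idealHS {H S : Set V} {a : V} (h : a ∈ S) :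
    vertH R E H a ∈ idealHS R E H S :=
  TwoSidedIdeal.subset_span (Or.inr ⟨a, h, rfl⟩)

theorem vertexSet_hereditary {a b : V} (ha : a ∈ vertexSet I) (h : E.Ge a b) :
    b ∈ vertexSet I := by
  obtain ⟨α, hα⟩ := h
  have h1 := ghostPath_mul_path_self (R := R) hα
  rw [← vert_mul_path hα] at h1
  change vert R E b ∈ I
  rw [← h1]
  exact I.mul_mem_left _ _ (I.mul_mem_right _ _ ha)

theorem edge_mem {e : Ed} (h : vert R E (E.r e) ∈ I) : edge R E e ∈ I := by
  rw [← (isLeavittFamily R E).edge_range]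
  exact I.mul_mem_left _ _ h

theorem ghost_mem {e : Ed} (h : vert R E (E.r e) ∈ I) : ghost R E e ∈ I := by
  rw [← (isLeavittFamily R E).range_ghost]
  exact I.mul_mem_right _ _ h

theorem vertexSet_saturated {a : V} (hne : (E.out a).Nonempty) (hfin : (E.out a).Finite)
    (h : ∀ e, E.s e = a → E.r e ∈ vertexSet I) : a ∈ vertexSet I := by
  change vert R E a ∈ I
  rw [(isLeavittFamily R E).vertex_sum a hfin hne]
  exact sum_mem fun e he => I.mul_mem_left _ _ (ghost_mem (h e (hfin.mem_toFinset.1 he)))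

end IdealInvariants

/-! ### Ideals under Condition (K) are generated by vertices and gap elements. -/

section Reduction

variable {R : Type w} [Field R] {V : Type u} {Ed : Type v} {E : DirGraph V Ed}

theorem mem_of_smul_mem (I : TwoSidedIdeal (LeavittPathAlgebra R E)) {c : R} (hc : c ≠ 0)
    {x : LeavittPathAlgebra R E} (h : c • x ∈ I) : x ∈ I := by
  have := smul_mem_ideal I c⁻¹ h
  rwa [smul_smul, inv_mul_cancel₀ hc, one_smul] at this

/-- Multiplying a nonzero combination of paths ending at `b` by a ghost path on the left yields
a nonzero multiple of `b` up to closed paths. -/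
theorem exists_ghostPath_mul_eq {b : V} {l : List Ed →₀ R} (hl : l ≠ 0)
    (hs : l ∈ Finsupp.supported R R {α | ∃ a, E.IsPath a α b}) :
    ∃ (α : List Ed) (c : R), c ≠ 0 ∧
      ∃ l' ∈ Finsupp.supported R R {γ | E.IsClosedPath b γ},
        ghostPath R E α b * Finsupp.linearCombination R (fun α => path R E α b) l =
          c • vert R E b + Finsupp.linearCombination R (fun α => path R E α b) l' := by
  classical
  rw [Finsupp.mem_supported] at hs
  -- With α of minimal length, any other β in the support either extends α properly or satisfies α*β
  -- = 0.
  obtain ⟨α, hα, hmin⟩ := Finset.exists_min_image l.support List.length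
    (Finsupp.support_nonempty_iff.2 hl)
  refine ⟨α, l α, Finsupp.mem_support_iff.1 hα, ?_⟩
  suffices h : ∑ β ∈ l.support.erase α, l β • (ghostPath R E α b * path R E β b) ∈
      Submodule.span R ((fun α => path R E α b) '' {γ | E.IsClosedPath b γ}) by
    obtain ⟨l', hl', h⟩ := (Finsupp.mem_span_image_iff_linearCombination R).1 h
    refine ⟨l', hl', ?_⟩
    obtain ⟨a, ha⟩ := hs hα
    rw [h, ← ghostPath_mul_path_self ha, Finsupp.linearCombination_apply, Finsupp.sum,
      Finset.mul_sum, ← Finset.add_sum_erase _ _ hα, mul_smul_comm]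
    simp only [mul_smul_comm]
  refine sum_mem fun β hβ => Submodule.smul_mem _ _ ?_
  obtain ⟨hne, hβ⟩ := Finset.mem_erase.1 hβ
  obtain ⟨a, ha⟩ := hs hα
  obtain ⟨c, hc⟩ := hs hβ
  by_cases hpre : α <+: β
  · obtain ⟨γ, rfl⟩ := hpre
    obtain ⟨d, h1, h2⟩ := isPath_append.1 hc
    have hγ : γ ≠ [] := by
      rintro rfl
      simp at hne
    -- An empty α does not force β = γ to start at b; if it starts elsewhere, the vertex b
    -- annihilates it.
    by_cases hd : d = b
    swap
    · cases α with
      | nil =>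
        cases h1
        rw [ghostPath_nil, List.nil_append, ← vert_mul_path h2, ← mul_assoc,
          (isLeavittFamily R E).orth _ _ (Ne.symm hd), zero_mul]
        exact zero_mem _
      | cons e α => exact (hd (h1.2.range_unique ha.2)).elim
    subst hd
    rw [ghostPath_mul_path_append ha h2]
    exact Submodule.subset_span ⟨γ, ⟨hγ, h2⟩, rfl⟩
  · rw [ghostPath_mul_path_of_not_prefix ha hc (hmin β hβ) hpre]
    exact zero_mem _

/-- Under Condition (K), an ideal that contains a nonzero combination of paths ending at `b`
contains `b`. -/
theorem vert_mem_of_linearCombination_mem (hK : E.ConditionK)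
    (I : TwoSidedIdeal (LeavittPathAlgebra R E)) {b : V} {l : List Ed →₀ R} (hl : l ≠ 0)
    (hs : l ∈ Finsupp.supported R R {α | ∃ a, E.IsPath a α b})
    (hI : Finsupp.linearCombination R (fun α => path R E α b) l ∈ I) : vert R E b ∈ I := by
  obtain ⟨α, c, hc, l', hl', h⟩ := exists_ghostPath_mul_eq hl hs
  rw [Finsupp.mem_supported] at hl'
  -- Conjugation by δ keeps the vertex, as δ*bδ = b, and kills every closed path γ, as δ is not an
  -- initial segment of γδ.
  obtain ⟨δ, hδ, hδ'⟩ := hK.exists_avoiding b l'.support hl'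
  refine mem_of_smul_mem I hc ?_
  have h1 := I.mul_mem_left (ghostPath R E α b) _ hI
  rw [h] at h1
  have h2 := I.mul_mem_left (ghostPath R E δ b) _ (I.mul_mem_right _ (path R E δ b) h1)
  have h3 : Finsupp.linearCombination R (fun α => path R E α b) l' * path R E δ b =
      ∑ γ ∈ l'.support, l' γ • path R E (γ ++ δ) b := by
    rw [Finsupp.linearCombination_apply, Finsupp.sum, Finset.sum_mul]
    exact Finset.sum_congr rfl fun γ _ => by rw [smul_mul_assoc, path_mul_path hδ]
  rw [add_mul, smul_mul_assoc, vert_mul_path hδ, mul_add, mul_smul_comm,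
    ghostPath_mul_path_self hδ, h3, Finset.mul_sum, Finset.sum_eq_zero, add_zero] at h2
  · exact h2
  · intro γ hγ
    rw [mul_smul_comm, ghostPath_mul_path_of_not_prefix hδ ((hl' hγ).2.append hδ)
      (by simp) (hδ' γ hγ), smul_zero]

/-- Here b^H itself does the work of δ: it annihilates the closed paths at b, because their first
edge ends outside H, else b would lie in H. -/
theorem vertH_mem_of_linearCombination_mul_mem
    (I : TwoSidedIdeal (LeavittPathAlgebra R E)) {b : V} {l : List Ed →₀ R} (hl : l ≠ 0)
    (hs : l ∈ Finsupp.supported R R {α | ∃ a, E.IsPath a α b}) (hb : b ∈ E.B (vertexSet I))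
    (hI : Finsupp.linearCombination R (fun α => path R E α b) l *
      vertH R E (vertexSet I) b ∈ I) : vertH R E (vertexSet I) b ∈ I := by
  obtain ⟨hbH, -, -, hfin⟩ := hb
  obtain ⟨α, c, hc, l', hl', h⟩ := exists_ghostPath_mul_eq hl hs
  rw [Finsupp.mem_supported] at hl'
  refine mem_of_smul_mem I hc ?_
  have h1 := I.mul_mem_left (ghostPath R E α b) _ hI
  rw [← mul_assoc, h] at h1
  have h2 := I.mul_mem_left (vertH R E (vertexSet I) b) _ h1
  have h3 : vertH R E (vertexSet I) b *
      Finsupp.linearCombination R (fun α => path R E α b) l' = 0 := by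
    rw [Finsupp.linearCombination_apply, Finsupp.sum, Finset.mul_sum]
    refine Finset.sum_eq_zero fun γ hγ => ?_
    obtain ⟨hne, hγ⟩ := hl' hγ
    obtain ⟨e, γ, rfl⟩ := List.exists_cons_of_ne_nil hne
    rw [mul_smul_comm, vertH_mul_path_cons hfin, smul_zero]
    exact fun hr => hbH (vertexSet_hereditary hr ⟨_, hγ.2⟩)
  rwa [← mul_assoc, mul_add, h3, add_zero, mul_smul_comm, vertH_mul_vert hfin,
    smul_mul_assoc, vertH_mul_vertH hfin] at h2

theorem linearCombination_path_mul_edge {l : List Ed →₀ R} (e : Ed) :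
    Finsupp.linearCombination R (fun α => path R E α (E.s e)) l * edge R E e =
      Finsupp.linearCombination R (fun α => path R E α (E.r e)) (l.mapDomain (· ++ [e])) := by
  rw [Finsupp.linearCombination_mapDomain, Finsupp.linearCombination_apply,
    Finsupp.linearCombination_apply, Finsupp.sum, Finsupp.sum, Finset.sum_mul]
  refine Finset.sum_congr rfl fun α _ => ?_
  rw [smul_mul_assoc, Function.comp_apply, ← path_mul_path (isPath_singleton e), path_cons,
    path_nil, (isLeavittFamily R E).edge_range]

/-- Under Condition (K), every ideal is generated by its vertices and its elements `a^H`. -/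
theorem eq_idealHS (hK : E.ConditionK) (I : TwoSidedIdeal (LeavittPathAlgebra R E)) :
    I = idealHS R E (vertexSet I) (gapSet I) := by
  classical
  refine le_antisymm (fun x hx => ?_) (idealHS_le I)
  set J := idealHS R E (vertexSet I) (gapSet I) with hJ
  have hJI : ∀ x ∈ J, x ∈ I := fun x hx => idealHS_le I hx
  have hvJ : ∀ a, vert R E a ∈ I → vert R E a ∈ J := fun a ha => vert_mem_idealHS ha
  obtain ⟨n, hn⟩ := exists_mem_ghostDegreeLE x
  -- Induction on the ghost degree: right multiplication by an edge lowers it, so x * e ∈ J in the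
  -- step. What remains is to recover x * b from these products, according to the edges from b that
  -- end outside H.
  induction n generalizing x with
  | zero =>
    refine mem_of_forall_mul_vert J fun b => ?_
    obtain ⟨l, hl, h⟩ :=
      (Finsupp.mem_span_image_iff_linearCombination R).1 (mul_vert_mem_span hn b)
    by_cases hb : vert R E b ∈ I
    · exact J.mul_mem_left _ _ (hvJ b hb)
    rw [← h]
    by_cases h0 : l = 0
    · rw [h0, map_zero]
      exact zero_mem J
    refine (hb (vert_mem_of_linearCombination_mem hK I h0 hl ?_)).elim
    rw [h]
    exact I.mul_mem_right _ _ hx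
  | succ n ih =>
    refine mem_of_forall_mul_vert J fun b => ?_
    by_cases hb : vert R E b ∈ I
    · exact J.mul_mem_left _ _ (hvJ b hb)
    have hedge : ∀ e, x * edge R E e ∈ J := fun e =>
      ih _ (I.mul_mem_right _ _ hx) (ghostDegreeLE_mul_edge hn e)
    obtain ⟨x₀, hx₀, F, y, hxy⟩ := exists_of_mem_ghostDegreeLE_succ hn
    obtain ⟨l, hl, h⟩ :=
      (Finsupp.mem_span_image_iff_linearCombination R).1 (mul_vert_mem_span hx₀ b)
    have hxb : x * vert R E b ∈ I := I.mul_mem_right _ _ hx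
    have hxb' : x * vert R E b = x₀ * vert R E b +
        ∑ e ∈ F with E.s e = b, y e * ghost R E e := by
      rw [hxy, add_mul, Finset.sum_mul, Finset.sum_filter]
      congr 1
      refine Finset.sum_congr rfl fun e _ => ?_
      rw [mul_assoc, ghost_mul_vert]
      split_ifs <;> simp
    by_cases hout : {e | E.s e = b ∧ E.r e ∉ vertexSet I}.Finite
    · by_cases hne : {e | E.s e = b ∧ E.r e ∉ vertexSet I}.Nonempty
      · by_cases hinf : (E.out b).Infinite
        · have hB : b ∈ E.B (vertexSet I) := ⟨hb, hinf, hne, hout⟩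
          -- Case b ∈ B_H: modulo J, x * b agrees with x * b^H, and then with the pure path part of
          -- x times b^H, since b^H turns each ghost edge into 0 or into an element of J.
          have h1 : x * vert R E b - x * vertH R E (vertexSet I) b ∈ J := by
            rw [vertH_eq hout, mul_sub, sub_sub_cancel, Finset.mul_sum]
            refine sum_mem fun e _ => ?_
            rw [← mul_assoc]
            exact J.mul_mem_right _ _ (hedge e)
          have h2 : x * vertH R E (vertexSet I) b -
              Finsupp.linearCombination R (fun α => path R E α b) l *
                vertH R E (vertexSet I) b ∈ J := by
            rw [h, ← vert_mul_vertH hout, ← mul_assoc, ← mul_assoc, mul_assoc x₀,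
              (isLeavittFamily R E).idem, hxb', add_mul, add_sub_cancel_left, Finset.sum_mul]
            refine sum_mem fun e he => ?_
            obtain ⟨-, he⟩ := Finset.mem_filter.1 he
            rw [mul_assoc, ghost_mul_vertH hout he]
            split_ifs with hr
            · exact J.mul_mem_left _ _ (ghost_mem (hvJ _ hr))
            · rw [mul_zero]
              exact zero_mem J
          have h3 : Finsupp.linearCombination R (fun α => path R E α b) l *
                vertH R E (vertexSet I) b ∈ J := by
            by_cases h0 : l = 0
            · rw [h0, map_zero, zero_mul]
              exact zero_mem J
            · refine J.mul_mem_left _ _ (vertH_mem_idealHS ⟨hB, ?_⟩)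
              refine vertH_mem_of_linearCombination_mul_mem I h0 hl hB ?_
              have h4 := hJI _ (add_mem h1 h2)
              rw [sub_add_sub_cancel] at h4
              have := sub_mem hxb h4
              rwa [sub_sub_cancel] at this
          have := add_mem (add_mem h1 h2) h3
          rwa [sub_add_sub_cancel, sub_add_cancel] at this
        · have hfin : (E.out b).Finite := Set.not_infinite.1 hinf
          obtain ⟨e, he, -⟩ := hne
          rw [(isLeavittFamily R E).vertex_sum b hfin ⟨e, he⟩, Finset.mul_sum]
          refine sum_mem fun e _ => ?_
          rw [← mul_assoc]
          exact J.mul_mem_right _ _ (hedge e)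
      -- All edges from b end in H, so the ghost part is in J; the pure path part then lies in I and
      -- must vanish because b ∉ I.
      · have h1 : ∑ e ∈ F with E.s e = b, y e * ghost R E e ∈ J := by
          refine sum_mem fun e he => J.mul_mem_left _ _ (ghost_mem (hvJ _ ?_))
          by_contra hr
          exact hne ⟨e, (Finset.mem_filter.1 he).2, hr⟩
        have h0 : l = 0 := by
          by_contra h0
          refine hb (vert_mem_of_linearCombination_mem hK I h0 hl ?_)
          rw [h, eq_sub_of_add_eq hxb'.symm]
          exact sub_mem hxb (hJI _ h1)
        rw [hxb', ← h, h0, map_zero, zero_add]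
        exact h1
    -- Infinitely many edges from b end outside H, so some f avoids F. Then x * f sees only the pure
    -- path part, and if this were nonzero, r(f) would lie in I.
    · obtain ⟨f, ⟨hf, hfr⟩, hfF⟩ := Set.Infinite.exists_notMem_finset hout F
      have h0 : l = 0 := by
        by_contra h0
        subst hf
        refine hfr (vert_mem_of_linearCombination_mem hK I (l := l.mapDomain (· ++ [f])) ?_ ?_ ?_)
        · intro h1
          refine h0 (Finsupp.mapDomain_injective (List.append_left_injective [f]) ?_)
          rw [h1, Finsupp.mapDomain_zero]
        · rw [Finsupp.mem_supported] at hl ⊢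
          intro α hα
          obtain ⟨β, hβ, rfl⟩ := Finset.mem_image.1 (Finsupp.mapDomain_support hα)
          obtain ⟨a, ha⟩ := hl hβ
          exact ⟨a, ha.append (isPath_singleton f)⟩
        · rw [← linearCombination_path_mul_edge, h, eq_sub_of_add_eq hxb'.symm, sub_mul,
            mul_assoc, (isLeavittFamily R E).source_edge, Finset.sum_mul, Finset.sum_eq_zero,
            sub_zero]
          · exact I.mul_mem_right _ _ hx
          · intro e he
            have hef : e ≠ f := by
              rintro rfl
              exact hfF (Finset.mem_filter.1 he).1
            rw [mul_assoc, (isLeavittFamily R E).ghost_edge_ne e f hef, mul_zero]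
      have h1 : x * vert R E b = ∑ e ∈ F with E.s e = b, y e * ghost R E e := by
        rw [hxb', ← h, h0, map_zero, zero_add]
      -- With the path part gone, the coefficient of each ghost edge is recovered from x * e, which
      -- lies in J by induction.
      have h2 : ∀ e ∈ F.filter (E.s · = b), x * edge R E e = y e * vert R E (E.r e) := by
        intro e he
        have hs := (Finset.mem_filter.1 he).2
        rw [← (isLeavittFamily R E).source_edge, ← mul_assoc, hs, h1, Finset.sum_mul]
        rw [Finset.sum_eq_single_of_mem e he, mul_assoc, (isLeavittFamily R E).ghost_edge]
        intro g _ hg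
        rw [mul_assoc, (isLeavittFamily R E).ghost_edge_ne g e hg, mul_zero]
      rw [h1]
      refine sum_mem fun e he => ?_
      rw [← (isLeavittFamily R E).range_ghost, ← mul_assoc, ← h2 e he]
      exact J.mul_mem_right _ _ (hedge e)

end Reduction

end LeavittPathAlgebra

/-! ### Primitive ideals are prime; primitive ideals from simple actions. -/

section Primitive

/-- Left primitive rings are prime, elementwise. -/
theorem IsLeftPrimitiveRing.eq_zero_or_eq_zero {A : Type u} [NonUnitalRing A]
    (h : IsLeftPrimitiveRing A) {a b : A} (hab : ∀ x, a * x * b = 0) : a = 0 ∨ b = 0 := by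
  obtain ⟨M, _, ρ, ⟨c, hc⟩, hsimple, hfaith⟩ := h
  have hmul : ∀ a b m, ρ (a * b) m = ρ a (ρ b m) := fun a b m => by rw [map_mul]; rfl
  by_contra! hne
  obtain ⟨ha, hb⟩ := hne
  obtain ⟨m, hm⟩ : ∃ m, ρ b m ≠ 0 := by
    by_contra! h0
    exact hb (hfaith b (AddMonoidHom.ext h0))
  -- The vectors killed by all of A form a submodule, which is proper because c acts nontrivially,
  -- hence zero.
  have hcyc : ∀ m, m ≠ 0 → ∃ x, ρ x m ≠ 0 := by
    intro m hm
    by_contra! h0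
    let N : AddSubgroup M :=
      { carrier := {m | ∀ x, ρ x m = 0}
        zero_mem' := fun x => map_zero _
        add_mem' := fun {m m'} h h' x => by rw [map_add, h x, h' x, add_zero]
        neg_mem' := fun {m} h x => by rw [map_neg, h x, neg_zero] }
    rcases hsimple N (fun a m hm x => by rw [hm a, map_zero]) with hN | hN
    · have : m ∈ N := h0
      rw [hN] at this
      exact hm this
    · refine hc (AddMonoidHom.ext fun m' => ?_)
      have : m' ∈ N := hN ▸ trivial
      exact this c
  obtain ⟨x, hx⟩ := hcyc _ hm
  -- N = A(bm) is nonzero, so it is all of M; yet a annihilates it, because aAb = 0.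
  let N : AddSubgroup M :=
    { carrier := {m' | ∃ x, ρ x (ρ b m) = m'}
      zero_mem' := ⟨0, by rw [map_zero]; rfl⟩
      add_mem' := by
        rintro _ _ ⟨x, rfl⟩ ⟨y, rfl⟩
        exact ⟨x + y, by rw [map_add]; rfl⟩
      neg_mem' := by
        rintro _ ⟨x, rfl⟩
        exact ⟨-x, by rw [map_neg]; rfl⟩ }
  rcases hsimple N (by rintro a _ ⟨x, rfl⟩; exact ⟨a * x, hmul _ _ _⟩) with hN | hN
  · have : ρ x (ρ b m) ∈ N := ⟨x, rfl⟩
    rw [hN] at this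
    exact hx this
  · refine ha (hfaith a (AddMonoidHom.ext fun m' => ?_))
    have : m' ∈ N := hN ▸ trivial
    obtain ⟨y, rfl⟩ := this
    have h0 : ρ (a * y * b) m = 0 := by
      rw [hab, map_zero]
      rfl
    rw [hmul, hmul] at h0
    exact h0

theorem IsLeftPrimitiveRing.exists_ne_zero {A : Type u} [NonUnitalRing A]
    (h : IsLeftPrimitiveRing A) : ∃ a : A, a ≠ 0 := by
  obtain ⟨M, _, ρ, ⟨c, hc⟩, -⟩ := h
  refine ⟨c, ?_⟩
  rintro rfl
  exact hc (map_zero ρ)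

namespace TwoSidedIdeal

variable {A : Type u} [NonUnitalRing A]

theorem toQuotient_eq_zero {I : TwoSidedIdeal A} {a : A} :
    I.ringCon.toQuotient a = 0 ↔ a ∈ I :=
  (RingCon.eq I.ringCon).trans Iff.rfl

theorem IsLeftPrimitiveIdeal.isPrimeIdeal {I : TwoSidedIdeal A} (h : I.IsLeftPrimitiveIdeal) :
    I.IsPrimeIdeal := by
  constructor
  · rintro rfl
    obtain ⟨a, ha⟩ := IsLeftPrimitiveRing.exists_ne_zero h
    obtain ⟨a, rfl⟩ := Quotient.exists_rep a
    exact ha (toQuotient_eq_zero.2 trivial)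
  · intro J₁ J₂ hJ
    by_contra! hne
    obtain ⟨h1, h2⟩ := hne
    obtain ⟨a, ha, ha'⟩ := Set.not_subset.1 h1
    obtain ⟨b, hb, hb'⟩ := Set.not_subset.1 h2
    have hab : ∀ x, I.ringCon.toQuotient a * x * I.ringCon.toQuotient b = 0 := by
      intro x
      obtain ⟨x, rfl⟩ := Quotient.exists_rep x
      exact toQuotient_eq_zero.2 (hJ _ (J₁.mul_mem_right _ _ ha) _ hb)
    rcases IsLeftPrimitiveRing.eq_zero_or_eq_zero h hab with h0 | h0
    · exact ha' (toQuotient_eq_zero.1 h0)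
    · exact hb' (toQuotient_eq_zero.1 h0)

theorem IsRightPrimitiveIdeal.isPrimeIdeal {I : TwoSidedIdeal A}
    (h : I.IsRightPrimitiveIdeal) : I.IsPrimeIdeal := by
  constructor
  · rintro rfl
    obtain ⟨a, ha⟩ := IsLeftPrimitiveRing.exists_ne_zero h
    obtain ⟨b, hb⟩ := Quotient.exists_rep a.unop
    exact ha (MulOpposite.unop_injective (hb.symm.trans (toQuotient_eq_zero.2 trivial)))
  · intro J₁ J₂ hJ
    by_contra! hne
    obtain ⟨h1, h2⟩ := hne
    obtain ⟨a, ha, ha'⟩ := Set.not_subset.1 h1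
    obtain ⟨b, hb, hb'⟩ := Set.not_subset.1 h2
    have hab : ∀ x, MulOpposite.op (I.ringCon.toQuotient b) * x *
        MulOpposite.op (I.ringCon.toQuotient a) = 0 := by
      intro x
      obtain ⟨y, hy⟩ := Quotient.exists_rep x.unop
      refine MulOpposite.unop_injective ?_
      rw [MulOpposite.unop_mul, MulOpposite.unop_mul, ← hy]
      exact toQuotient_eq_zero.2 (hJ _ ha _ (J₂.mul_mem_left _ _ hb))
    rcases IsLeftPrimitiveRing.eq_zero_or_eq_zero h hab with h0 | h0
    · exact hb' (toQuotient_eq_zero.1 (MulOpposite.op_injective h0))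
    · exact ha' (toQuotient_eq_zero.1 (MulOpposite.op_injective h0))

/-- The kernel of a non-unital ring homomorphism is a left primitive ideal if the action through
it on an abelian group is simple. -/
theorem isLeftPrimitiveIdeal_of_action {M : Type u} [AddCommGroup M] (I : TwoSidedIdeal A)
    (ρ : A →ₙ+* AddMonoid.End M) (hker : ∀ a, a ∈ I ↔ ρ a = 0) (hne : ∃ a, ρ a ≠ 0)
    (hsimple : ∀ N : AddSubgroup M, (∀ a, ∀ m ∈ N, ρ a m ∈ N) → N = ⊥ ∨ N = ⊤) :
    I.IsLeftPrimitiveIdeal := by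
  have hlift : ∀ a b, I.ringCon a b → ρ a = ρ b := fun a b h => by
    rw [rel_iff, hker, map_sub] at h
    exact sub_eq_zero.1 h
  let σ : I.ringCon.Quotient →ₙ+* AddMonoid.End M :=
    { toFun := fun a => Quotient.liftOn' a ρ hlift
      map_zero' := map_zero ρ
      map_add' := by
        rintro ⟨a⟩ ⟨b⟩
        exact map_add ρ a b
      map_mul' := by
        rintro ⟨a⟩ ⟨b⟩
        exact map_mul ρ a b }
  refine ⟨M, _, σ, ?_, fun N hN => hsimple N fun a => hN (I.ringCon.toQuotient a), ?_⟩
  · obtain ⟨a, ha⟩ := hne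
    exact ⟨I.ringCon.toQuotient a, ha⟩
  · rintro ⟨a⟩ ha
    exact toQuotient_eq_zero.2 ((hker a).2 ha)

theorem isRightPrimitiveIdeal_of_action {M : Type u} [AddCommGroup M] (I : TwoSidedIdeal A)
    (ρ : A →ₙ+* (AddMonoid.End M)ᵐᵒᵖ) (hker : ∀ a, a ∈ I ↔ ρ a = 0) (hne : ∃ a, ρ a ≠ 0)
    (hsimple : ∀ N : AddSubgroup M, (∀ a, ∀ m ∈ N, (ρ a).unop m ∈ N) → N = ⊥ ∨ N = ⊤) :
    I.IsRightPrimitiveIdeal := by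
  have hlift : ∀ a b, I.ringCon a b → ρ a = ρ b := fun a b h => by
    rw [rel_iff, hker, map_sub] at h
    exact sub_eq_zero.1 h
  let σ : I.ringCon.Quotient →ₙ+* (AddMonoid.End M)ᵐᵒᵖ :=
    { toFun := fun a => Quotient.liftOn' a ρ hlift
      map_zero' := map_zero ρ
      map_add' := by
        rintro ⟨a⟩ ⟨b⟩
        exact map_add ρ a b
      map_mul' := by
        rintro ⟨a⟩ ⟨b⟩
        exact map_mul ρ a b }
  let τ : I.ringCon.Quotientᵐᵒᵖ →ₙ+* AddMonoid.End M :=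
    { toFun := fun a => (σ a.unop).unop
      map_zero' := by simp
      map_add' := by simp
      map_mul' := by simp }
  refine ⟨M, _, τ, ?_, fun N hN => hsimple N fun a => hN (.op (I.ringCon.toQuotient a)), ?_⟩
  · obtain ⟨a, ha⟩ := hne
    exact ⟨.op (I.ringCon.toQuotient a), fun h => ha (MulOpposite.unop_injective h)⟩
  · intro a ha
    obtain ⟨b, hb⟩ := Quotient.exists_rep a.unop
    refine MulOpposite.unop_injective (hb.symm.trans (toQuotient_eq_zero.2 ((hker b).2 ?_)))
    refine MulOpposite.unop_injective ?_
    have h1 : (σ a.unop).unop = 0 := ha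
    rw [← hb] at h1
    exact h1

end TwoSidedIdeal

end Primitive

/-! ### Prime ideals are tail ideals. -/

namespace LeavittPathAlgebra

open DirGraph

variable {R : Type w} [Field R] {V : Type u} {Ed : Type v} {E : DirGraph V Ed}

/-- Prime ideals of `L_R(E)` are prime elementwise. -/
theorem exists_mul_notMem {I : TwoSidedIdeal (LeavittPathAlgebra R E)} (h : I.IsPrimeIdeal)
    {a b : LeavittPathAlgebra R E} (ha : a ∉ I) (hb : b ∉ I) : ∃ x, a * x * b ∉ I := by
  by_contra! hab
  -- Instead of generated ideals, two annihilators modulo I are used: J₁ contains a and J₂ contains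
  -- b. A right unit of y ∈ J₁ gives y * z ∈ I for z ∈ J₂.
  let J₁ : TwoSidedIdeal (LeavittPathAlgebra R E) := .mk' {y | ∀ x, y * x * b ∈ I}
    (fun x => by
      rw [zero_mul, zero_mul]
      exact zero_mem I)
    (fun {y z} hy hz x => by
      rw [add_mul, add_mul]
      exact add_mem (hy x) (hz x))
    (fun {y} hy x => by
      rw [neg_mul, neg_mul]
      exact neg_mem (hy x))
    (fun {y z} hz x => by
      rw [mul_assoc y, mul_assoc y]
      exact I.mul_mem_left _ _ (hz x))
    (fun {y z} hy x => by
      rw [mul_assoc y]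
      exact hy _)
  let J₂ : TwoSidedIdeal (LeavittPathAlgebra R E) := .mk' {z | ∀ y ∈ J₁, ∀ x, y * x * z ∈ I}
    (fun y _ x => by
      rw [mul_zero]
      exact zero_mem I)
    (fun {z z'} hz hz' y hy x => by
      rw [mul_add]
      exact add_mem (hz y hy x) (hz' y hy x))
    (fun {z} hz y hy x => by
      rw [mul_neg]
      exact neg_mem (hz y hy x))
    (fun {t z} hz y hy x => by
      rw [← mul_assoc, mul_assoc y]
      exact hz y hy _)
    (fun {z t} hz y hy x => by
      rw [← mul_assoc]
      exact I.mul_mem_right _ _ (hz y hy x))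
  have h1 : ∀ y, y ∈ J₁ ↔ ∀ x, y * x * b ∈ I := fun y => TwoSidedIdeal.mem_mk' _ _ _ _ _ _ _
  have h2 : ∀ z, z ∈ J₂ ↔ ∀ y ∈ J₁, ∀ x, y * x * z ∈ I :=
    fun z => TwoSidedIdeal.mem_mk' _ _ _ _ _ _ _
  have hJ : ∀ y ∈ J₁, ∀ z ∈ J₂, y * z ∈ I := by
    intro y hy z hz
    obtain ⟨F, hF⟩ := exists_right_unit y
    rw [← hF]
    exact (h2 z).1 hz y hy _
  rcases h.2 J₁ J₂ hJ with h | h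
  · exact ha (h ((h1 a).2 hab))
  · exact hb (h ((h2 b).2 fun y hy => (h1 y).1 hy))

/-- Monomials span, so the element that links x to y can be taken to be some αβ*. Primeness thus
yields actual paths in the graph. -/
theorem exists_monomial_notMem {I : TwoSidedIdeal (LeavittPathAlgebra R E)} (h : I.IsPrimeIdeal)
    {x y : LeavittPathAlgebra R E} (hx : x ∉ I) (hy : y ∉ I) :
    ∃ a b c α β, E.IsPath a α b ∧ E.IsPath c β b ∧
      x * (path R E α b * ghostPath R E β b) * y ∉ I := by
  obtain ⟨z, hz⟩ := exists_mul_notMem h hx hy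
  by_contra! h0
  refine hz (monomial_induction (p := fun z => x * z * y ∈ I) z ?_ ?_ ?_ ?_)
  · rw [mul_zero, zero_mul]
    exact zero_mem I
  · intro z z' hz hz'
    rw [mul_add, add_mul]
    exact add_mem hz hz'
  · intro c z hz
    rw [mul_smul_comm, smul_mul_assoc]
    exact smul_mem_ideal I c hz
  · intro a b c α β hα hβ
    exact h0 a b c α β hα hβ

theorem vert_mul_path_of_ne {a b c : V} {α : List Ed} (h : E.IsPath a α b) (hne : c ≠ a) :
    vert R E c * path R E α b = 0 := by
  rw [← vert_mul_path h, ← mul_assoc, (isLeavittFamily R E).orth _ _ hne, zero_mul]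

theorem ghostPath_mul_vert {a b : V} {α : List Ed} (h : E.IsPath a α b) :
    ghostPath R E α b * vert R E a = ghostPath R E α b := by
  cases α with
  | nil =>
    cases h
    exact (isLeavittFamily R E).idem _
  | cons e α =>
    obtain ⟨rfl, -⟩ := h
    rw [ghostPath_cons, mul_assoc, (isLeavittFamily R E).ghost_source]

theorem ghostPath_mul_vert_of_ne {a b c : V} {α : List Ed} (h : E.IsPath a α b) (hne : a ≠ c) :
    ghostPath R E α b * vert R E c = 0 := by
  rw [← ghostPath_mul_vert h, mul_assoc, (isLeavittFamily R E).orth _ _ hne, mul_zero]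

theorem omega_compl {M : Set V} (hM : ∀ a b, b ∈ M → E.Ge a b → a ∈ M) : E.Omega M = Mᶜ := by
  ext b
  exact ⟨fun h => h.1, fun h => ⟨h, fun a ha hba => h (hM b a ha hba)⟩⟩

/-- MT1 and MT2 hold for the vertices outside any ideal. MT3 is where primeness enters: a monomial
αβ* linking a to b must have α starting at a and β at b, and their common range is the required
vertex. -/
theorem isMaximalTail_of_isPrimeIdeal {I : TwoSidedIdeal (LeavittPathAlgebra R E)}
    (h : I.IsPrimeIdeal) : E.IsMaximalTail (vertexSet I)ᶜ where
  nonempty := by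
    by_contra hne
    rw [Set.not_nonempty_iff_eq_empty, Set.compl_empty_iff] at hne
    exact h.1 (eq_top_of_forall_vert_mem I fun a => (hne ▸ Set.mem_univ a : a ∈ vertexSet I))
  mt1 a b hb hab ha := hb (vertexSet_hereditary ha hab)
  mt2 a ha hne hfin := by
    by_contra! h0
    exact ha (vertexSet_saturated hne hfin fun e he => not_not.1 (h0 e he))
  mt3 a ha b hb := by
    obtain ⟨a', y, b', α, β, hα, hβ, hx⟩ := exists_monomial_notMem h ha hb
    have ha' : a = a' := by
      by_contra hne
      rw [← mul_assoc, vert_mul_path_of_ne hα hne, zero_mul, zero_mul] at hx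
      exact hx (zero_mem I)
    have hb' : b' = b := by
      by_contra hne
      rw [mul_assoc, mul_assoc, ghostPath_mul_vert_of_ne hβ hne, mul_zero, mul_zero] at hx
      exact hx (zero_mem I)
    subst ha' hb'
    refine ⟨y, fun hy => hx ?_, ⟨α, hα⟩, ⟨β, hβ⟩⟩
    rw [← path_mul_vert_self]
    exact I.mul_mem_right _ _ (I.mul_mem_left _ _ (I.mul_mem_right _ _ (I.mul_mem_left _ _ hy)))

/-- Modulo I the element a^H acts as a sink: edges into H already lie in I, and a^H annihilates the
others. -/
theorem vertH_mul_path_mem {I : TwoSidedIdeal (LeavittPathAlgebra R E)} {a b : V}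
    (ha : {e | E.s e = a ∧ E.r e ∉ vertexSet I}.Finite) (e : Ed) (α : List Ed) :
    vertH R E (vertexSet I) a * path R E (e :: α) b ∈ I := by
  by_cases hr : E.r e ∈ vertexSet I
  · rw [path_cons]
    exact I.mul_mem_left _ _ (I.mul_mem_right _ _ (edge_mem hr))
  · rw [vertH_mul_path_cons ha hr]
    exact zero_mem I

theorem ghostPath_mul_vertH_mem {I : TwoSidedIdeal (LeavittPathAlgebra R E)} {a b : V}
    (ha : {e | E.s e = a ∧ E.r e ∉ vertexSet I}.Finite) (e : Ed) (α : List Ed) :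
    ghostPath R E (e :: α) b * vertH R E (vertexSet I) a ∈ I := by
  classical
  by_cases hr : E.r e ∈ vertexSet I
  · rw [ghostPath_cons]
    exact I.mul_mem_right _ _ (I.mul_mem_left _ _ (ghost_mem hr))
  · rw [ghostPath_cons, mul_assoc]
    refine I.mul_mem_left _ _ ?_
    by_cases hs : E.s e = a
    · rw [ghost_mul_vertH ha hs, if_neg hr]
      exact zero_mem I
    · rw [← vert_mul_vertH ha, ← mul_assoc, ghost_mul_vert, if_neg hs, zero_mul]
      exact zero_mem I

theorem mem_tailIdeals_of_isPrimeIdeal (hK : E.ConditionK)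
    {I : TwoSidedIdeal (LeavittPathAlgebra R E)} (h : I.IsPrimeIdeal) : I ∈ tailIdeals R E := by
  have hM := isMaximalTail_of_isPrimeIdeal h
  have hO : E.Omega (vertexSet I)ᶜ = vertexSet I := by rw [omega_compl hM.mt1, compl_compl]
  -- If all gap elements lie in I, then I is of the first kind; a missing one singles out the
  -- breaking vertex.
  by_cases hS : E.B (vertexSet I) ⊆ gapSet I
  · refine Or.inl ⟨_, hM, ?_⟩
    rw [hO]
    conv_lhs => rw [eq_idealHS hK I]
    rw [Set.Subset.antisymm (fun a ha => ha.1) hS]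
  obtain ⟨a, haB, haS⟩ := Set.not_subset.1 hS
  have haI : vertH R E (vertexSet I) a ∉ I := fun h => haS ⟨haB, h⟩
  have hOa : E.Omega {a} = vertexSet I := by
    refine Set.Subset.antisymm (fun b hb => ?_) fun b hb => ⟨?_, ?_⟩
    · by_contra hbI
      -- A monomial linking b to a^H has β empty by the sink property, so α is a path from b to a.
      obtain ⟨b', y, a', α, β, hα, hβ, hx⟩ := exists_monomial_notMem h hbI haI
      rcases β with _ | ⟨e, β⟩
      swap
      · rw [mul_assoc, mul_assoc] at hx
        exact hx (I.mul_mem_left _ _ (I.mul_mem_left _ _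
          (ghostPath_mul_vertH_mem haB.2.2.2 e β)))
      have hb' : b = b' := by
        by_contra hne
        rw [← mul_assoc, vert_mul_path_of_ne hα hne, zero_mul, zero_mul] at hx
        exact hx (zero_mem I)
      have hy : y = a := by
        by_contra hne
        rw [ghostPath_nil, ← vert_mul_vertH haB.2.2.2, mul_assoc, mul_assoc,
          ← mul_assoc (vert R E y), (isLeavittFamily R E).orth y a hne, zero_mul, mul_zero,
          mul_zero] at hx
        exact hx (zero_mem I)
      subst hb' hy
      exact hb.2 _ rfl ⟨α, hα⟩
    · rintro rfl
      exact haB.1 hb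
    · rintro _ rfl hba
      exact haB.1 (vertexSet_hereditary hb hba)
  refine Or.inr ⟨a, ⟨haB.2.1, hOa ▸ haB⟩, ?_⟩
  rw [hOa]
  conv_lhs => rw [eq_idealHS hK I]
  congr 1
  ext b
  refine ⟨fun hb => ⟨hb.1, ?_⟩, fun hb => ?_⟩
  · rintro rfl
    exact haS hb
  · by_contra hbS
    have hbI : vertH R E (vertexSet I) b ∉ I := fun h => hbS ⟨hb.1, h⟩
    -- Between two gap elements outside I both α and β are empty, so the link is a single vertex
    -- equal to both a and b.
    obtain ⟨a', y, b', α, β, hα, hβ, hx⟩ := exists_monomial_notMem h haI hbI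
    rcases β with _ | ⟨e, β⟩
    swap
    · rw [mul_assoc, mul_assoc] at hx
      exact hx (I.mul_mem_left _ _ (I.mul_mem_left _ _
        (ghostPath_mul_vertH_mem hb.1.2.2.2 e β)))
    rcases α with _ | ⟨e, α⟩
    swap
    · rw [← mul_assoc] at hx
      exact hx (I.mul_mem_right _ _ (I.mul_mem_right _ _ (vertH_mul_path_mem haB.2.2.2 e α)))
    refine hb.2 ?_
    by_contra hne
    have hab : a ≠ b := fun h => hne h.symm
    by_cases hya : a = y
    · subst hya
      rw [ghostPath_nil, ← vert_mul_vertH hb.1.2.2.2, mul_assoc, mul_assoc,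
        ← mul_assoc (vert R E a), (isLeavittFamily R E).orth a b hab, zero_mul, mul_zero,
        mul_zero] at hx
      exact hx (zero_mem I)
    · rw [path_nil, ← mul_assoc, ← vertH_mul_vert haB.2.2.2, mul_assoc (vertH R E _ a),
        (isLeavittFamily R E).orth a y hya, mul_zero, zero_mul, zero_mul] at hx
      exact hx (zero_mem I)

end LeavittPathAlgebra

/-! ### Branching systems and the simplicity of their modules. -/

open DirGraph

/-- An algebraic branching system: a set `X` with a source map in which every element either is
terminal (`hd x = none`) or splits uniquely as an edge followed by another element. -/
structure BranchingSystem {V : Type u} {Ed : Type v} (E : DirGraph V Ed) (X : Type x) where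
  src : X → V
  hd : X → Option Ed
  tl : X → X
  cons : Ed → X → X
  src_eq : ∀ x e, hd x = some e → src x = E.s e
  src_tl : ∀ x e, hd x = some e → src (tl x) = E.r e
  cons_tl : ∀ x e, hd x = some e → cons e (tl x) = x
  hd_cons : ∀ x e, src x = E.r e → hd (cons e x) = some e
  tl_cons : ∀ x e, src x = E.r e → tl (cons e x) = x
  tl_eq_self : ∀ x, hd x = none → tl x = x
  hd_ne_none : ∀ x, (E.out (src x)).Finite → (E.out (src x)).Nonempty → hd x ≠ none

namespace BranchingSystem

variable {V : Type u} {Ed : Type v} {E : DirGraph V Ed} {X : Type x} (B : BranchingSystem E X)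
variable (R : Type w) [Field R]

open Classical in
/-- The action of a vertex. -/
noncomputable def opV (a : V) : Module.End R (X →₀ R) :=
  Finsupp.linearCombination R fun x => if B.src x = a then Finsupp.single x 1 else 0

open Classical in
/-- The action of an edge. -/
noncomputable def opE (e : Ed) : Module.End R (X →₀ R) :=
  Finsupp.linearCombination R fun x =>
    if B.src x = E.r e then Finsupp.single (B.cons e x) 1 else 0

open Classical in
/-- The action of a ghost edge. -/
noncomputable def opG (e : Ed) : Module.End R (X →₀ R) :=
  Finsupp.linearCombination R fun x => if B.hd x = some e then Finsupp.single (B.tl x) 1 else 0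

variable {R}

theorem opV_single [DecidableEq V] (a : V) (x : X) (c : R) :
    B.opV R a (Finsupp.single x c) = if B.src x = a then Finsupp.single x c else 0 := by
  rw [opV, Finsupp.linearCombination_single]
  split_ifs <;> simp

theorem opE_single [DecidableEq V] (e : Ed) (x : X) (c : R) :
    B.opE R e (Finsupp.single x c) =
      if B.src x = E.r e then Finsupp.single (B.cons e x) c else 0 := by
  rw [opE, Finsupp.linearCombination_single]
  split_ifs <;> simp

theorem opG_single [DecidableEq Ed] (e : Ed) (x : X) (c : R) :
    B.opG R e (Finsupp.single x c) =
      if B.hd x = some e then Finsupp.single (B.tl x) c else 0 := by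
  rw [opG, Finsupp.linearCombination_single]
  split_ifs <;> simp

theorem end_ext {f g : Module.End R (X →₀ R)}
    (h : ∀ x, f (Finsupp.single x 1) = g (Finsupp.single x 1)) : f = g :=
  Finsupp.lhom_ext' fun x => LinearMap.ext_ring (h x)

theorem opE_mul_opG_single [DecidableEq Ed] (e : Ed) (x : X) (c : R) :
    (B.opE R e * B.opG R e) (Finsupp.single x c) =
      if B.hd x = some e then Finsupp.single x c else 0 := by
  classical
  rw [Module.End.mul_apply, opG_single]
  split_ifs with h
  · rw [opE_single, if_pos (B.src_tl x e h), B.cons_tl x e h]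
  · rw [map_zero]

theorem sum_opE_mul_opG_single [DecidableEq Ed] (s : Finset Ed) (x : X) (c : R) :
    (∑ e ∈ s, B.opE R e * B.opG R e) (Finsupp.single x c) =
      if ∃ e ∈ s, B.hd x = some e then Finsupp.single x c else 0 := by
  rw [LinearMap.sum_apply, Finset.sum_congr rfl fun e _ => B.opE_mul_opG_single e x c]
  split_ifs with h
  · obtain ⟨e, he, h⟩ := h
    rw [Finset.sum_eq_single_of_mem e he, if_pos h]
    intro f _ hfe
    rw [if_neg]
    rw [h]
    exact fun h' => hfe (Option.some_injective _ h').symm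
  · push Not at h
    exact Finset.sum_eq_zero fun e he => if_neg (h e he)

theorem isLeavittFamily : E.IsLeavittFamily (B.opV R) (B.opE R) (B.opG R) := by
  classical
  refine ⟨fun a => ?_, fun a b hab => ?_, fun e => ?_, fun e => ?_, fun e => ?_, fun e => ?_,
    fun e => ?_, fun e f hef => ?_, fun a hfin hne => ?_⟩
  all_goals refine end_ext fun x => ?_
  · rw [Module.End.mul_apply, opV_single]
    split_ifs with h
    · rw [opV_single, if_pos h]
    · rw [map_zero]
  · rw [Module.End.mul_apply, opV_single]
    split_ifs with h
    · rw [opV_single, if_neg (h.trans_ne hab.symm)]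
      all_goals simp_all
    · rw [map_zero]
      rfl
  · rw [Module.End.mul_apply, opE_single]
    split_ifs with h
    · rw [opV_single, if_pos (B.src_eq _ e (B.hd_cons x e h))]
    · rw [map_zero]
  · rw [Module.End.mul_apply, opV_single, opE_single]
    split_ifs with h
    · rw [opE_single, if_pos h]
    · rw [map_zero]
  · rw [Module.End.mul_apply, opG_single]
    split_ifs with h
    · rw [opV_single, if_pos (B.src_tl x e h)]
    · rw [map_zero]
  · rw [Module.End.mul_apply, opV_single, opG_single]
    by_cases h : B.hd x = some e
    · rw [if_pos (B.src_eq x e h), opG_single]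
    · split_ifs
      · rw [opG_single, if_neg h]
      · rw [map_zero]
  · rw [Module.End.mul_apply, opE_single, opV_single]
    split_ifs with h
    · rw [opG_single, if_pos (B.hd_cons x e h), B.tl_cons x e h]
    · rw [map_zero]
  · rw [Module.End.mul_apply, opE_single]
    split_ifs with h
    · rw [opG_single, if_neg]
      · rfl
      · rw [B.hd_cons x f h]
        exact fun h' => hef (Option.some_injective _ h').symm
    · rw [map_zero]
      rfl
  · rw [sum_opE_mul_opG_single, opV_single]
    refine if_congr ⟨?_, ?_⟩ rfl rfl
    · rintro rfl
      obtain ⟨e, he⟩ := Option.ne_none_iff_exists'.1 (B.hd_ne_none x hfin hne)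
      exact ⟨e, hfin.mem_toFinset.2 (B.src_eq x e he).symm, he⟩
    · rintro ⟨e, he, h⟩
      exact (B.src_eq x e h).trans (hfin.mem_toFinset.1 he)

theorem opV_eq_zero_iff {a : V} : B.opV R a = 0 ↔ ∀ x, B.src x ≠ a := by
  classical
  constructor
  · rintro h x hx
    have h1 := LinearMap.congr_fun h (Finsupp.single x 1)
    rw [opV_single, if_pos hx] at h1
    exact one_ne_zero (Finsupp.single_eq_zero.1 h1)
  · intro h
    refine end_ext fun x => ?_
    rw [opV_single, if_neg (h x)]
    rfl

/-- The vertices that act as zero. -/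
def nullSet : Set V := {a | ∀ x, B.src x ≠ a}

/-- The operator is the projection onto the terminal basis elements at a: if x starts with e, then
`tl x` has source r(e), so r(e) ∉ `nullSet` and e occurs in the sum. -/
theorem gap_eq_zero_iff {a : V} (hfin : {e | E.s e = a ∧ E.r e ∉ B.nullSet}.Finite) :
    B.opV R a - ∑ e ∈ hfin.toFinset, B.opE R e * B.opG R e = 0 ↔
      ∀ x, B.src x = a → B.hd x ≠ none := by
  classical
  constructor
  · rintro h x hx hn
    have h1 := LinearMap.congr_fun h (Finsupp.single x 1)
    rw [LinearMap.sub_apply, sum_opE_mul_opG_single, opV_single, if_pos hx, if_neg, sub_zero] at h1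
    · exact one_ne_zero (Finsupp.single_eq_zero.1 h1)
    · simp [hn]
  · intro h
    refine end_ext fun x => ?_
    rw [LinearMap.sub_apply, sum_opE_mul_opG_single, opV_single]
    refine sub_eq_zero.2 (if_congr ⟨?_, ?_⟩ rfl rfl)
    · rintro hx
      obtain ⟨e, he⟩ := Option.ne_none_iff_exists'.1 (h x hx)
      exact ⟨e, hfin.mem_toFinset.2
        ⟨(B.src_eq x e he).symm.trans hx, fun h0 => h0 _ (B.src_tl x e he)⟩, he⟩
    · rintro ⟨e, he, h⟩
      exact (B.src_eq x e h).trans (hfin.mem_toFinset.1 he).1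

section Simple

/-- On the elements with first edge e, `tl` is injective with left inverse `cons e`, so coefficients
never merge. -/
theorem opG_apply_tl {e : Ed} {x : X} (hx : B.hd x = some e) (f : X →₀ R) :
    B.opG R e f (B.tl x) = f x := by
  classical
  induction f using Finsupp.induction_linear with
  | zero => simp
  | add f g hf hg => simp [hf, hg]
  | single y c =>
    rw [opG_single]
    by_cases hxy : y = x
    · subst hxy
      rw [if_pos hx]
      simp
    · rw [Finsupp.single_eq_of_ne' hxy]
      split_ifs with hy
      · refine Finsupp.single_eq_of_ne' fun h => hxy ?_
        rw [← B.cons_tl x e hx, ← h, B.cons_tl y e hy]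
      · rfl

theorem support_opG_subset [DecidableEq X] [DecidableEq Ed] (e : Ed) (f : X →₀ R) :
    (B.opG R e f).support ⊆ (f.support.filter (B.hd · = some e)).image B.tl := by
  intro y hy
  have h : ∃ x, B.hd x = some e ∧ B.tl x = y := by
    by_contra! h
    refine Finsupp.mem_support_iff.1 hy ?_
    induction f using Finsupp.induction_linear with
    | zero => simp
    | add f g hf hg =>
      by_contra hne
      rw [map_add, Finsupp.add_apply] at hne
      by_cases h1 : B.opG R e f y = 0
      · by_cases h2 : B.opG R e g y = 0
        · rw [h1, h2, add_zero] at hne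
          exact hne rfl
        · exact h2 (hg (Finsupp.mem_support_iff.2 h2))
      · exact h1 (hf (Finsupp.mem_support_iff.2 h1))
    | single x c =>
      rw [opG_single]
      split_ifs with hx
      · exact Finsupp.single_eq_of_ne' (h x hx)
      · rfl
  obtain ⟨x, hx, rfl⟩ := h
  rw [Finsupp.mem_support_iff, B.opG_apply_tl hx] at hy
  exact Finset.mem_image_of_mem _ (Finset.mem_filter.2 ⟨Finsupp.mem_support_iff.2 hy, hx⟩)

theorem card_support_opG_le (e : Ed) (f : X →₀ R) :
    (B.opG R e f).support.card ≤ f.support.card := by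
  classical
  exact ((Finset.card_le_card (B.support_opG_subset e f)).trans Finset.card_image_le).trans
    (Finset.card_filter_le _ _)

theorem opG_smaller_support {e : Ed} {f : X →₀ R} {x y : X} (hx : f x ≠ 0) (hy : f y ≠ 0)
    (hxe : B.hd x = some e) (hye : B.hd y ≠ some e) :
    B.opG R e f ≠ 0 ∧ (B.opG R e f).support.card < f.support.card := by
  classical
  refine ⟨fun h => hx ?_, ?_⟩
  · rw [← B.opG_apply_tl hxe, h]
    rfl
  · refine ((Finset.card_le_card (B.support_opG_subset e f)).trans
      Finset.card_image_le).trans_lt (Finset.card_lt_card ?_)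
    exact Finset.filter_ssubset.2 ⟨y, Finsupp.mem_support_iff.2 hy, hye⟩

/-- Ghost edges strip the common initial edges of x and y without enlarging the support; at the
first disagreement one further ghost edge keeps one of them and kills the other. -/
theorem exists_smaller_support {N : AddSubgroup (X →₀ R)}
    (hG : ∀ e, ∀ f ∈ N, B.opG R e f ∈ N) (n : ℕ) {f : X →₀ R} (hf : f ∈ N) {x y : X}
    (hx : f x ≠ 0) (hy : f y ≠ 0) (hxy : B.hd (B.tl^[n] x) ≠ B.hd (B.tl^[n] y)) :
    ∃ g ∈ N, g ≠ 0 ∧ g.support.card < f.support.card := by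
  by_cases h : B.hd x = B.hd y
  · induction n generalizing f x y with
    | zero => exact (hxy h).elim
    | succ n ih =>
      rw [Function.iterate_succ_apply, Function.iterate_succ_apply] at hxy
      cases hxe : B.hd x with
      | none =>
        rw [B.tl_eq_self x hxe, B.tl_eq_self y (h ▸ hxe)] at hxy
        exact ih hf hx hy hxy h
      | some e =>
        have hx' : B.opG R e f (B.tl x) ≠ 0 := by rwa [B.opG_apply_tl hxe]
        have hy' : B.opG R e f (B.tl y) ≠ 0 := by rwa [B.opG_apply_tl (h ▸ hxe)]
        suffices ∃ g ∈ N, g ≠ 0 ∧ g.support.card < (B.opG R e f).support.card by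
          obtain ⟨g, hg, hg0, hcard⟩ := this
          exact ⟨g, hg, hg0, hcard.trans_le (B.card_support_opG_le e f)⟩
        -- `ih` requires the heads to agree; if they already differ after one step, a second ghost
        -- edge separates them at once.
        by_cases h' : B.hd (B.tl x) = B.hd (B.tl y)
        · exact ih (hG e f hf) hx' hy' hxy h'
        · cases hxe' : B.hd (B.tl x) with
          | some e' =>
            have := B.opG_smaller_support hx' hy' hxe' (fun h0 => h' (hxe'.trans h0.symm))
            exact ⟨_, hG _ _ (hG e f hf), this⟩
          | none =>
            obtain ⟨e', hye'⟩ := Option.ne_none_iff_exists'.1 (hxe' ▸ Ne.symm h')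
            have := B.opG_smaller_support hy' hx' hye' (fun h0 => h' (h0.trans hye'.symm))
            exact ⟨_, hG _ _ (hG e f hf), this⟩
  · cases hxe : B.hd x with
    | some e =>
      exact ⟨_, hG e f hf, B.opG_smaller_support hx hy hxe fun h0 => h (hxe.trans h0.symm)⟩
    | none =>
      obtain ⟨e, hye⟩ := Option.ne_none_iff_exists'.1 (hxe ▸ Ne.symm h)
      exact ⟨_, hG e f hf, B.opG_smaller_support hy hx hye fun h0 => h (h0.trans hye.symm)⟩

/-- Any two elements have a common tail. -/
def TailConnected : Prop := ∀ x y, ∃ m n : ℕ, B.tl^[m] x = B.tl^[n] y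

/-- Elements are determined by their sequence of edges. -/
def Separated : Prop := ∀ x y, x ≠ y → ∃ n : ℕ, B.hd (B.tl^[n] x) ≠ B.hd (B.tl^[n] y)

variable {B}

theorem Separated.exists_single_mem (hB : B.Separated) {N : AddSubgroup (X →₀ R)}
    (hG : ∀ e, ∀ f ∈ N, B.opG R e f ∈ N) {f : X →₀ R} (hf : f ∈ N) (h0 : f ≠ 0) :
    ∃ x c, c ≠ 0 ∧ Finsupp.single x c ∈ N := by
  induction hcard : f.support.card using Nat.strong_induction_on generalizing f with
  | _ k ih =>
    obtain ⟨x, hx⟩ := Finsupp.ne_iff.1 h0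
    by_cases h : ∃ y, y ≠ x ∧ f y ≠ 0
    · obtain ⟨y, hyx, hy⟩ := h
      obtain ⟨n, hn⟩ := hB y x hyx
      obtain ⟨g, hg, hg0, hlt⟩ := B.exists_smaller_support hG n hf hy hx hn
      exact ih _ (hcard ▸ hlt) hg hg0 rfl
    · push Not at h
      refine ⟨x, f x, hx, ?_⟩
      have : Finsupp.single x (f x) = f := by
        classical
        ext y
        by_cases hxy : y = x
        · rw [hxy, Finsupp.single_eq_same]
        · rw [Finsupp.single_eq_of_ne hxy, h y hxy]
      rwa [this]

/-- Separation reduces a nonzero vector of N to a multiple of one basis element x. Any y is then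
reached by going down from x to a common tail with ghost edges and up to y with edges. -/
theorem eq_bot_or_eq_top (hB : B.Separated) (hT : B.TailConnected) {N : AddSubgroup (X →₀ R)}
    (hV : ∀ (c : R) a, ∀ f ∈ N, (c • B.opV R a) f ∈ N) (hE : ∀ e, ∀ f ∈ N, B.opE R e f ∈ N)
    (hG : ∀ e, ∀ f ∈ N, B.opG R e f ∈ N) : N = ⊥ ∨ N = ⊤ := by
  classical
  refine or_iff_not_imp_left.2 fun hN => ?_
  obtain ⟨f, hf, h0⟩ := N.bot_or_exists_ne_zero.resolve_left hN
  obtain ⟨x, c, hc, hx⟩ := hB.exists_single_mem hG hf h0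
  -- N is only an additive subgroup, so rescaling has to come from the algebra, through a scalar
  -- multiple of the vertex at the source of x.
  have hscale : ∀ {x : X} {c d : R}, c ≠ 0 → Finsupp.single x c ∈ N →
      Finsupp.single x d ∈ N := by
    intro x c d hc hx
    have := hV (d * c⁻¹) (B.src x) _ hx
    rwa [LinearMap.smul_apply, opV_single, if_pos rfl, Finsupp.smul_single, smul_eq_mul,
      mul_assoc, inv_mul_cancel₀ hc, mul_one] at this
  have htl : ∀ (n : ℕ) {x : X}, Finsupp.single x (1 : R) ∈ N →
      Finsupp.single (B.tl^[n] x) (1 : R) ∈ N := by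
    intro n
    induction n with
    | zero => exact fun h => h
    | succ n ih =>
      intro x hx
      rw [Function.iterate_succ_apply]
      refine ih ?_
      cases hxe : B.hd x with
      | none => rwa [B.tl_eq_self x hxe]
      | some e =>
        have := hG e _ hx
        rwa [opG_single, if_pos hxe] at this
  have htl' : ∀ (n : ℕ) {x : X}, Finsupp.single (B.tl^[n] x) (1 : R) ∈ N →
      Finsupp.single x (1 : R) ∈ N := by
    intro n
    induction n with
    | zero => exact fun h => h
    | succ n ih =>
      intro x hx
      rw [Function.iterate_succ_apply] at hx
      have hx := ih hx
      cases hxe : B.hd x with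
      | none => rwa [B.tl_eq_self x hxe] at hx
      | some e =>
        have := hE e _ hx
        rwa [opE_single, if_pos (B.src_tl x e hxe), B.cons_tl x e hxe] at this
  refine eq_top_iff.2 fun g _ => ?_
  induction g using Finsupp.induction_linear with
  | zero => exact zero_mem N
  | add f g hf hg => exact add_mem (hf trivial) (hg trivial)
  | single y d =>
    obtain ⟨m, n, hmn⟩ := hT x y
    refine hscale one_ne_zero (htl' n (hmn ▸ htl m ?_))
    exact hscale hc hx

end Simple

end BranchingSystem

/-! ### Primitive ideals from branching systems. -/

namespace LeavittPathAlgebra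

variable {R : Type w} [Field R] {V : Type u} {Ed : Type v} {E : DirGraph V Ed}

/-- The kernel of a homomorphism out of `L_R(E)`, under Condition (K). -/
theorem ker_eq_idealHS (hK : E.ConditionK) {A : Type x} [NonUnitalRing A] [Module R A]
    (φ : LeavittPathAlgebra R E →ₙₐ[R] A) {H S : Set V} (hH : ∀ a, φ (vert R E a) = 0 ↔ a ∈ H)
    (hS : ∀ a, a ∈ S ↔ a ∈ E.B H ∧ φ (vertH R E H a) = 0) :
    TwoSidedIdeal.ker φ = idealHS R E H S := by
  have h1 : vertexSet (TwoSidedIdeal.ker φ) = H :=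
    Set.ext fun a => (TwoSidedIdeal.mem_ker φ).trans (hH a)
  have h2 : gapSet (TwoSidedIdeal.ker φ) = S := by
    ext a
    rw [hS, gapSet, h1]
    exact and_congr_right fun _ => TwoSidedIdeal.mem_ker φ
  rw [eq_idealHS hK (TwoSidedIdeal.ker φ), h1, h2]

/-- The Leavitt relations are symmetric under reversing products and exchanging e with e*, so each
left module over L_R(E) also gives a right module on the same space. -/
theorem isLeavittFamily_op {A : Type x} [NonUnitalRing A] {p : V → A} {q q' : Ed → A}
    (h : E.IsLeavittFamily p q q') :
    E.IsLeavittFamily (A := Aᵐᵒᵖ) (fun a => .op (p a)) (fun e => .op (q' e))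
      (fun e => .op (q e)) where
  idem a := MulOpposite.unop_injective (h.idem a)
  orth a b hab := MulOpposite.unop_injective (h.orth b a hab.symm)
  source_edge e := MulOpposite.unop_injective (h.ghost_source e)
  edge_range e := MulOpposite.unop_injective (h.range_ghost e)
  range_ghost e := MulOpposite.unop_injective (h.edge_range e)
  ghost_source e := MulOpposite.unop_injective (h.source_edge e)
  ghost_edge e := MulOpposite.unop_injective (h.ghost_edge e)
  ghost_edge_ne e f hef := MulOpposite.unop_injective (h.ghost_edge_ne f e hef.symm)
  vertex_sum a hf hne := MulOpposite.unop_injective <| by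
    rw [MulOpposite.unop_op, h.vertex_sum a hf hne, Finset.unop_sum]
    rfl

-- With this universe, `X →₀ R` lies in the universe of L_R(E), as `IsLeftPrimitiveRing` asks of its
-- module.
variable {X : Type (max u v)} {B : BranchingSystem E X}

/-- The module `X →₀ R` is simple, and its annihilator is determined by the vertices and gap
elements acting as zero, by `ker_eq_idealHS`. -/
theorem isLeftPrimitiveIdeal_of_branchingSystem [Nonempty X] (hK : E.ConditionK)
    (hB : B.Separated) (hT : B.TailConnected) :
    (idealHS R E B.nullSet
      {a | a ∈ E.B B.nullSet ∧ ∀ x, B.src x = a → B.hd x ≠ none}).IsLeftPrimitiveIdeal := by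
  obtain ⟨φ, hv, he, hg⟩ := exists_hom (R := R) (B.isLeavittFamily (R := R))
  let T : Module.End R (X →₀ R) →+* AddMonoid.End (X →₀ R) :=
    Module.toAddMonoidEnd (Module.End R (X →₀ R)) (X →₀ R)
  have hT0 : ∀ f, T f = 0 → f = 0 := fun f hf => LinearMap.ext fun m => DFunLike.congr_fun hf m
  let ρ : LeavittPathAlgebra R E →ₙ+* AddMonoid.End (X →₀ R) :=
    (T : _ →ₙ+* _).comp (φ : LeavittPathAlgebra R E →ₙ+* Module.End R (X →₀ R))
  have hρ : ∀ a m, ρ a m = φ a m := fun _ _ => rfl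
  rw [← ker_eq_idealHS hK φ (fun a => by rw [hv, B.opV_eq_zero_iff]; rfl) fun a => ?_]
  · refine TwoSidedIdeal.isLeftPrimitiveIdeal_of_action (M := X →₀ R) _ ρ (fun a => ?_) ?_ ?_
    · rw [TwoSidedIdeal.mem_ker]
      refine ⟨fun h => ?_, fun h => hT0 _ h⟩
      exact AddMonoidHom.ext fun m => (hρ a m).trans (LinearMap.congr_fun h m)
    · obtain ⟨x⟩ := ‹Nonempty X›
      refine ⟨vert R E (B.src x), fun h => ?_⟩
      have h0 : φ (vert R E (B.src x)) = 0 := hT0 _ h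
      rw [hv] at h0
      exact B.opV_eq_zero_iff.1 h0 x rfl
    · intro N hN
      refine B.eq_bot_or_eq_top hB hT (fun c a f hf => ?_) (fun e f hf => ?_) fun e f hf => ?_
      · rw [← hv, ← map_smul]
        exact hN _ _ hf
      · rw [← he]
        exact hN _ _ hf
      · rw [← hg]
        exact hN _ _ hf
  · refine and_congr_right fun ha => ?_
    rw [vertH_eq ha.2.2.2, map_sub, map_sum, hv]
    simp only [map_mul, he, hg]
    exact (B.gap_eq_zero_iff ha.2.2.2).symm

theorem isRightPrimitiveIdeal_of_branchingSystem [Nonempty X] (hK : E.ConditionK)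
    (hB : B.Separated) (hT : B.TailConnected) :
    (idealHS R E B.nullSet
      {a | a ∈ E.B B.nullSet ∧ ∀ x, B.src x = a → B.hd x ≠ none}).IsRightPrimitiveIdeal := by
  obtain ⟨φ, hv, he, hg⟩ := exists_hom (R := R) (isLeavittFamily_op (B.isLeavittFamily (R := R)))
  let T : Module.End R (X →₀ R) →+* AddMonoid.End (X →₀ R) :=
    Module.toAddMonoidEnd (Module.End R (X →₀ R)) (X →₀ R)
  have hT0 : ∀ f, T.op f = 0 → f = 0 := fun f hf => MulOpposite.unop_injective <|
    LinearMap.ext fun m => DFunLike.congr_fun (congrArg MulOpposite.unop hf) m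
  let ρ : LeavittPathAlgebra R E →ₙ+* (AddMonoid.End (X →₀ R))ᵐᵒᵖ :=
    (T.op : _ →ₙ+* _).comp (φ : LeavittPathAlgebra R E →ₙ+* (Module.End R (X →₀ R))ᵐᵒᵖ)
  have hρ : ∀ a m, (ρ a).unop m = (φ a).unop m := fun _ _ => rfl
  rw [← ker_eq_idealHS hK φ (fun a => ?_) fun a => ?_]
  · refine TwoSidedIdeal.isRightPrimitiveIdeal_of_action (M := X →₀ R) _ ρ (fun a => ?_) ?_ ?_
    · rw [TwoSidedIdeal.mem_ker]
      refine ⟨fun h => ?_, fun h => hT0 _ h⟩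
      exact MulOpposite.unop_injective (AddMonoidHom.ext fun m => (hρ a m).trans
        (LinearMap.congr_fun (congrArg MulOpposite.unop h) m))
    · obtain ⟨x⟩ := ‹Nonempty X›
      refine ⟨vert R E (B.src x), fun h => ?_⟩
      have h0 : φ (vert R E (B.src x)) = 0 := hT0 _ h
      rw [hv, MulOpposite.op_eq_zero_iff] at h0
      exact B.opV_eq_zero_iff.1 h0 x rfl
    · intro N hN
      refine B.eq_bot_or_eq_top hB hT (fun c a f hf => ?_) (fun e f hf => ?_) fun e f hf => ?_
      · have := hN (c • vert R E a) f hf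
        rwa [hρ, map_smul, hv] at this
      · have := hN (ghost R E e) f hf
        rwa [hρ, hg] at this
      · have := hN (edge R E e) f hf
        rwa [hρ, he] at this
  · rw [hv, MulOpposite.op_eq_zero_iff, B.opV_eq_zero_iff]
    rfl
  · refine and_congr_right fun ha => ?_
    rw [vertH_eq ha.2.2.2, map_sub, map_sum, hv]
    simp only [map_mul, he, hg, ← MulOpposite.op_mul, ← Finset.op_sum,
      ← MulOpposite.op_sub, MulOpposite.op_eq_zero_iff]
    exact (B.gap_eq_zero_iff ha.2.2.2).symm

end LeavittPathAlgebra

namespace DirGraph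

variable {V : Type u} {Ed : Type v} {E : DirGraph V Ed}

/-! ### The branching system of finite paths into a vertex. -/

section FinitePaths

/-- The finite paths with range `b`. -/
structure PathsTo (E : DirGraph V Ed) (b : V) where
  src : V
  edges : List Ed
  isPath : E.IsPath src edges b

namespace PathsTo

variable {b : V}

@[ext]
theorem ext {x y : E.PathsTo b} (h : x.edges = y.edges) : x = y := by
  obtain ⟨a, α, hα⟩ := x
  obtain ⟨c, β, hβ⟩ := y
  obtain rfl : α = β := h
  cases α with
  | nil =>
    obtain rfl : a = b := hα
    obtain rfl : c = a := hβ
    rfl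
  | cons e α =>
    obtain rfl : E.s e = a := hα.1
    obtain rfl : E.s e = c := hβ.1
    rfl

/-- Remove the first edge of a path, if there is one. -/
def tail : E.PathsTo b → E.PathsTo b
  | ⟨a, [], h⟩ => ⟨a, [], h⟩
  | ⟨_, e :: α, h⟩ => ⟨E.r e, α, h.2⟩

open Classical in
/-- Put an edge in front of a path if it fits. -/
noncomputable def consEdge (e : Ed) (x : E.PathsTo b) : E.PathsTo b :=
  if h : x.src = E.r e then ⟨E.s e, e :: x.edges, rfl, h ▸ x.isPath⟩ else x

theorem consEdge_eq {e : Ed} {x : E.PathsTo b} (h : x.src = E.r e) :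
    consEdge e x = ⟨E.s e, e :: x.edges, rfl, h ▸ x.isPath⟩ := dif_pos h

/-- The finite paths ending at a sink or an infinite emitter form a branching system. -/
noncomputable def branchingSystem (hb : (E.out b).Nonempty → (E.out b).Infinite) :
    BranchingSystem E (E.PathsTo b) where
  src := src
  hd x := x.edges.head?
  tl := tail
  cons := consEdge
  src_eq := by
    rintro ⟨a, _ | ⟨f, α⟩, h⟩ e he
    · cases he
    · cases he
      exact h.1.symm
  src_tl := by
    rintro ⟨a, _ | ⟨f, α⟩, h⟩ e he
    · cases he
    · cases he
      rfl
  cons_tl := by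
    rintro ⟨a, _ | ⟨f, α⟩, h⟩ e he
    · cases he
    · cases he
      refine PathsTo.ext ?_
      rw [consEdge_eq (by rfl)]
      rfl
  hd_cons := by
    intro x e h
    rw [consEdge_eq h]
    rfl
  tl_cons := by
    intro x e h
    rw [consEdge_eq h]
    exact PathsTo.ext rfl
  tl_eq_self := by
    rintro ⟨a, _ | ⟨f, α⟩, h⟩ he
    · rfl
    · cases he
  hd_ne_none := by
    -- Only the empty path at b is terminal, and `hb` says that b is a sink or an infinite emitter.
    rintro ⟨a, _ | ⟨f, α⟩, h⟩ hfin hne he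
    · obtain rfl : a = b := h
      exact hb hne hfin
    · cases he

variable (hb : (E.out b).Nonempty → (E.out b).Infinite)

theorem exists_iterate_tail (x : E.PathsTo b) : ∃ n, tail^[n] x = ⟨b, [], rfl⟩ := by
  obtain ⟨a, α, h⟩ := x
  induction α generalizing a with
  | nil => exact ⟨0, PathsTo.ext rfl⟩
  | cons e α ih =>
    obtain ⟨n, hn⟩ := ih _ h.2
    exact ⟨n + 1, hn⟩

theorem tailConnected : (branchingSystem hb).TailConnected := by
  intro x y
  obtain ⟨m, hm⟩ := x.exists_iterate_tail
  obtain ⟨n, hn⟩ := y.exists_iterate_tail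
  exact ⟨m, n, hm.trans hn.symm⟩

theorem separated : (branchingSystem hb).Separated := by
  rintro ⟨a, α, h⟩ ⟨c, β, h'⟩ hne
  by_contra! heq
  refine hne (PathsTo.ext ?_)
  change α = β
  clear hne
  induction α generalizing a c β with
  | nil =>
    cases β with
    | nil => rfl
    | cons f β =>
      have h0 : (none : Option Ed) = some f := heq 0
      cases h0
  | cons e α ih =>
    cases β with
    | nil =>
      have h0 : some e = (none : Option Ed) := heq 0
      cases h0
    | cons f β =>
      have h0 : some e = some f := heq 0
      cases h0
      rw [ih _ h.2 _ _ h'.2 fun n => heq (n + 1)]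

theorem mem_nullSet {a : V} : a ∈ (branchingSystem hb).nullSet ↔ ¬ E.Ge a b := by
  constructor
  · rintro h ⟨α, hα⟩
    exact h ⟨a, α, hα⟩ rfl
  · rintro h ⟨a, α, hα⟩ rfl
    exact h ⟨α, hα⟩

/-- The empty path at b is the only terminal element, so b is the only vertex whose gap element can
act nontrivially. -/
theorem forall_hd_ne_none {a : V} :
    (∀ x, (branchingSystem hb).src x = a → (branchingSystem hb).hd x ≠ none) ↔ a ≠ b := by
  constructor
  · rintro h rfl
    exact h ⟨a, [], rfl⟩ rfl rfl
  · rintro hne ⟨a, _ | ⟨e, α⟩, hα⟩ rfl h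
    · exact hne hα
    · cases h

end PathsTo

end FinitePaths

/-! ### The branching system of a tail class of infinite paths. -/

section InfinitePaths

/-- The infinite paths sharing a tail with the sequence of edges `p`. -/
structure TailClass (E : DirGraph V Ed) (p : ℕ → Ed) where
  src : V
  seq : ℕ → Ed
  src_eq : E.s (seq 0) = src
  isPath : ∀ n, E.r (seq n) = E.s (seq (n + 1))
  tail_eq : ∃ m n, ∀ k, seq (m + k) = p (n + k)

namespace TailClass

variable {p : ℕ → Ed}

@[ext]
theorem ext {x y : E.TailClass p} (h : x.seq = y.seq) : x = y := by
  obtain ⟨a, q, ha, _, _⟩ := x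
  obtain ⟨b, q', hb, _, _⟩ := y
  obtain rfl : q = q' := h
  obtain rfl := ha
  obtain rfl := hb
  rfl

/-- Remove the first edge of an infinite path. -/
def tail (x : E.TailClass p) : E.TailClass p where
  src := E.r (x.seq 0)
  seq k := x.seq (k + 1)
  src_eq := (x.isPath 0).symm
  isPath n := x.isPath (n + 1)
  tail_eq := by
    obtain ⟨m, n, h⟩ := x.tail_eq
    exact ⟨m, n + 1, fun k => by rw [add_assoc, h, add_right_comm, add_assoc]⟩

/-- Put an edge in front of an infinite path. -/
def consOf (e : Ed) (x : E.TailClass p) (h : x.src = E.r e) : E.TailClass p where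
  src := E.s e
  seq k := Nat.casesOn k e x.seq
  src_eq := rfl
  isPath n := by
    cases n with
    | zero => exact h.symm.trans x.src_eq.symm
    | succ n => exact x.isPath n
  tail_eq := by
    obtain ⟨m, n, h⟩ := x.tail_eq
    refine ⟨m + 1, n, fun k => ?_⟩
    rw [add_right_comm]
    exact h k

open Classical in
/-- Put an edge in front of an infinite path if it fits. -/
noncomputable def consEdge (e : Ed) (x : E.TailClass p) : E.TailClass p :=
  if h : x.src = E.r e then x.consOf e h else x

theorem consEdge_eq {e : Ed} {x : E.TailClass p} (h : x.src = E.r e) :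
    consEdge e x = x.consOf e h := dif_pos h

/-- A tail equivalence class of infinite paths is a branching system. -/
noncomputable def branchingSystem (p : ℕ → Ed) : BranchingSystem E (E.TailClass p) where
  src := src
  hd x := some (x.seq 0)
  tl := tail
  cons := consEdge
  src_eq := by
    rintro x e he
    cases he
    exact x.src_eq.symm
  src_tl := by
    rintro x e he
    cases he
    rfl
  cons_tl := by
    rintro x e he
    cases he
    rw [consEdge_eq (by rfl)]
    refine TailClass.ext (funext fun k => ?_)
    cases k <;> rfl
  hd_cons := by
    intro x e h
    rw [consEdge_eq h]
    rfl
  tl_cons := by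
    rintro x e h
    rw [consEdge_eq h]
    exact TailClass.ext rfl
  tl_eq_self := by
    rintro x he
    cases he
  hd_ne_none := by
    rintro x - - he
    cases he

theorem iterate_tail (n : ℕ) (x : E.TailClass p) (k : ℕ) :
    (tail^[n] x).seq k = x.seq (n + k) := by
  induction n generalizing k with
  | zero => rw [zero_add]; rfl
  | succ n ih =>
    rw [Function.iterate_succ_apply', add_right_comm]
    exact ih (k + 1)

theorem tailConnected : (branchingSystem (E := E) p).TailConnected := by
  intro x y
  obtain ⟨m, n, h⟩ := x.tail_eq
  obtain ⟨m', n', h'⟩ := y.tail_eq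
  refine ⟨m + n', m' + n, TailClass.ext (funext fun k => ?_)⟩
  refine (iterate_tail _ x k).trans (Eq.trans ?_ (iterate_tail _ y k).symm)
  rw [add_assoc, h, add_assoc, h', add_left_comm]

theorem separated : (branchingSystem (E := E) p).Separated := by
  intro x y hne
  by_contra! heq
  refine hne (TailClass.ext (funext fun n => ?_))
  have h1 : some ((tail^[n] x).seq 0) = some ((tail^[n] y).seq 0) := heq n
  rw [iterate_tail, iterate_tail] at h1
  exact Option.some_injective _ h1

theorem ge_seq (x : E.TailClass p) (n : ℕ) : E.Ge x.src (E.s (x.seq n)) := by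
  induction n with
  | zero => exact x.src_eq ▸ Ge.refl _
  | succ n ih => exact ih.trans (x.isPath n ▸ ge_edge (x.seq n))

/-- A tail of `p` as an element of its class. -/
def shift (hp : ∀ n, E.r (p n) = E.s (p (n + 1))) (n : ℕ) : E.TailClass p where
  src := E.s (p n)
  seq k := p (n + k)
  src_eq := rfl
  isPath k := hp (n + k)
  tail_eq := ⟨0, n, fun k => by rw [zero_add]⟩

theorem exists_src_eq (hp : ∀ n, E.r (p n) = E.s (p (n + 1))) {a : V} {n : ℕ}
    {α : List Ed} (h : E.IsPath a α (E.s (p n))) : ∃ x : E.TailClass p, x.src = a := by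
  induction α generalizing a with
  | nil => exact ⟨shift hp n, h.symm⟩
  | cons e α ih =>
    obtain ⟨x, hx⟩ := ih h.2
    exact ⟨x.consOf e hx, h.1⟩

theorem mem_nullSet (hp : ∀ n, E.r (p n) = E.s (p (n + 1))) {a : V} :
    a ∈ (branchingSystem (E := E) p).nullSet ↔ ¬ ∃ n, E.Ge a (E.s (p n)) := by
  constructor
  · rintro h ⟨n, α, hα⟩
    obtain ⟨x, hx⟩ := exists_src_eq hp hα
    exact h x hx
  · rintro h x rfl
    obtain ⟨m, n, h1⟩ := x.tail_eq
    exact h ⟨n, h1 0 ▸ x.ge_seq m⟩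

end TailClass

end InfinitePaths

/-! ### Maximal tails of a countable graph. -/

section MaximalTails

/-- A nonempty path to `target`, which is reachable from the vertex `f idx`: an intermediate stage
in the construction of an infinite path. -/
structure Stage (E : DirGraph V Ed) (M : Set V) (f : ℕ → V) where
  idx : ℕ
  e : Ed
  rest : List Ed
  target : V
  mem : target ∈ M
  isPath : E.IsPath (E.r e) rest target
  ge : E.Ge (f idx) target

/-- With M enumerated by f, nonempty paths are concatenated, the n-th one ending at a vertex of M
reachable from f n. Nonemptiness makes the result infinite, and each vertex of M connects to it. A
`Stage` records the current edge and the unread rest of the current piece, so that one step emits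
one edge. -/
theorem exists_infinite_path {M : Set V} (hmt1 : ∀ a b, b ∈ M → E.Ge a b → a ∈ M) {f : ℕ → V}
    (hf : ∀ a, a ∈ M ↔ ∃ n, f n = a)
    (h : ∀ a ∈ M, ∀ b ∈ M, ∃ y ∈ M, ∃ α ≠ [], E.IsPath a α y ∧ E.Ge b y) :
    ∃ p : ℕ → Ed, (∀ n, E.r (p n) = E.s (p (n + 1))) ∧ ∀ a, a ∈ M ↔ ∃ n, E.Ge a (E.s (p n)) := by
  have hfM : ∀ n, f n ∈ M := fun n => (hf _).2 ⟨n, rfl⟩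
  have hstart : ∀ a ∈ M, ∀ n, ∃ st : E.Stage M f, E.s st.e = a ∧ st.idx = n := by
    intro a ha n
    obtain ⟨y, hy, α, hne, hα, hge⟩ := h a ha (f n) (hfM n)
    obtain ⟨e, α, rfl⟩ := List.exists_cons_of_ne_nil hne
    exact ⟨⟨n, e, α, y, hy, hα.2, hge⟩, hα.1, rfl⟩
  -- The next edge of the piece is read; when the piece is used up, a new one is started at its
  -- target for the next index.
  have hstep : ∀ st : E.Stage M f, ∃ st' : E.Stage M f, E.s st'.e = E.r st.e ∧
      (st.rest = [] → st'.idx = st.idx + 1) ∧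
      (st.rest ≠ [] → st'.idx = st.idx ∧ st'.rest.length < st.rest.length) := by
    rintro ⟨n, e, _ | ⟨e', α⟩, y, hy, hα, hge⟩
    · cases hα
      obtain ⟨st, h1, h2⟩ := hstart _ hy (n + 1)
      exact ⟨st, h1, fun _ => h2, fun h => (h rfl).elim⟩
    · exact ⟨⟨n, e', α, y, hy, hα.2, hge⟩, hα.1, fun h => (List.cons_ne_nil _ _ h).elim,
        fun _ => ⟨rfl, Nat.lt_succ_self _⟩⟩
  choose next hnext using hstep
  obtain ⟨st₀, -, h₀⟩ := hstart (f 0) (hfM 0) 0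
  let S : ℕ → E.Stage M f := fun n => next^[n] st₀
  have hS : ∀ n, S (n + 1) = next (S n) := fun n => Function.iterate_succ_apply' _ _ _
  have hdone : ∀ k, ∃ k', (S k').idx = (S k).idx ∧ (S k').rest = [] := by
    intro k
    induction hl : (S k).rest.length using Nat.strong_induction_on generalizing k with
    | _ l ih =>
      by_cases hr : (S k).rest = []
      · exact ⟨k, rfl, hr⟩
      · obtain ⟨h1, h2⟩ := (hnext (S k)).2.2 hr
        rw [← hS] at h1 h2
        obtain ⟨k', h3, h4⟩ := ih _ (hl ▸ h2) (k + 1) rfl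
        exact ⟨k', h3.trans h1, h4⟩
  have hidx : ∀ n, ∃ k, (S k).idx = n ∧ (S k).rest = [] := by
    intro n
    induction n with
    | zero =>
      obtain ⟨k, h1, h2⟩ := hdone 0
      exact ⟨k, h1.trans h₀, h2⟩
    | succ n ih =>
      obtain ⟨k, h1, h2⟩ := ih
      obtain ⟨k', h3, h4⟩ := hdone (k + 1)
      refine ⟨k', ?_, h4⟩
      rw [h3, hS, (hnext _).2.1 h2, h1]
  have hpath : ∀ n, E.r (S n).e = E.s (S (n + 1)).e := fun n => by rw [hS, (hnext _).1]
  refine ⟨fun n => (S n).e, hpath, fun a => ⟨fun ha => ?_, ?_⟩⟩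
  · obtain ⟨n, rfl⟩ := (hf a).1 ha
    obtain ⟨k, rfl, hk⟩ := hidx n
    refine ⟨k + 1, ?_⟩
    have h1 := (S k).isPath
    rw [hk] at h1
    have h2 : E.r (S k).e = (S k).target := h1
    rw [← hpath, h2]
    exact (S k).ge
  · rintro ⟨n, hn⟩
    exact hmt1 _ _ (S n).mem (hn.trans ((ge_edge _).trans ⟨_, (S n).isPath⟩))

/-- A maximal tail of a countable graph consists of the vertices that connect to some infinite
path, or of those that connect to a vertex without edges into the tail. -/
theorem IsMaximalTail.exists_path_or_vertex [Countable V] {M : Set V} (hM : E.IsMaximalTail M) :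
    (∃ p : ℕ → Ed, (∀ n, E.r (p n) = E.s (p (n + 1))) ∧
      ∀ a, a ∈ M ↔ ∃ n, E.Ge a (E.s (p n))) ∨
    ∃ b ∈ M, (∀ a, a ∈ M ↔ E.Ge a b) ∧ ∀ e, E.s e = b → E.r e ∉ M := by
  by_cases h : ∀ a ∈ M, ∀ b ∈ M, ∃ y ∈ M, ∃ α ≠ [], E.IsPath a α y ∧ E.Ge b y
  · obtain ⟨f, hf⟩ := (Set.to_countable M).exists_eq_range hM.nonempty
    exact Or.inl (exists_infinite_path hM.mt1 (f := f) (fun a => by rw [hf]; rfl) h)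
  · right
    push Not at h
    obtain ⟨b, hb, c, hc, h⟩ := h
    -- No nonempty path from b ends in M at a vertex below c, so the common vertex given by MT3 is b
    -- itself. Hence c ≥ b, and no nonempty path from b ends in M at all.
    have hcb : E.Ge c b := by
      obtain ⟨y, hy, ⟨α, hα⟩, hcy⟩ := hM.mt3 b hb c hc
      by_cases h0 : α = []
      · subst h0
        cases hα
        exact hcy
      · exact (h y hy α h0 hα hcy).elim
    have hno : ∀ y ∈ M, ∀ α ≠ [], ¬ E.IsPath b α y := fun y hy α hne hα =>
      h y hy α hne hα (hcb.trans ⟨α, hα⟩)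
    refine ⟨b, hb, fun a => ⟨fun ha => ?_, fun hab => hM.mt1 a b hb hab⟩, ?_⟩
    · obtain ⟨y, hy, ⟨α, hα⟩, hay⟩ := hM.mt3 b hb a ha
      by_cases h0 : α = []
      · subst h0
        cases hα
        exact hay
      · exact (hno y hy α h0 hα).elim
    · rintro e rfl he
      exact hno _ he [e] (by simp) (isPath_singleton e)

end MaximalTails

end DirGraph

/-! ### Tail ideals are primitive, and the conclusion. -/

namespace LeavittPathAlgebra

open DirGraph

variable {R : Type w} [Field R] {V : Type u} {Ed : Type v} {E : DirGraph V Ed}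

/-- This covers two cases: b is a breaking vertex and S omits it from B_H, or b ∉ B_H and S is all
of B_H. -/
theorem isPrimitiveIdeal_of_vertex (hK : E.ConditionK) {b : V}
    (hb : (E.out b).Nonempty → (E.out b).Infinite) {H S : Set V} (hH : ∀ a, a ∈ H ↔ ¬ E.Ge a b)
    (hS : ∀ a, a ∈ S ↔ a ∈ E.B H ∧ a ≠ b) :
    (idealHS R E H S).IsLeftPrimitiveIdeal ∧ (idealHS R E H S).IsRightPrimitiveIdeal := by
  have : Nonempty (E.PathsTo b) := ⟨⟨b, [], rfl⟩⟩
  have h1 : (PathsTo.branchingSystem hb).nullSet = H :=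
    Set.ext fun a => (PathsTo.mem_nullSet hb).trans (hH a).symm
  have h2 : {a | a ∈ E.B H ∧ ∀ x, (PathsTo.branchingSystem hb).src x = a →
      (PathsTo.branchingSystem hb).hd x ≠ none} = S :=
    Set.ext fun a => (and_congr_right fun _ => PathsTo.forall_hd_ne_none hb).trans (hS a).symm
  have hl := isLeftPrimitiveIdeal_of_branchingSystem (R := R) hK (PathsTo.separated hb)
    (PathsTo.tailConnected hb)
  have hr := isRightPrimitiveIdeal_of_branchingSystem (R := R) hK (PathsTo.separated hb)
    (PathsTo.tailConnected hb)
  rw [h1, h2] at hl hr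
  exact ⟨hl, hr⟩

/-- Infinite paths are never terminal, so every gap element acts as zero and all of B_H appears. -/
theorem isPrimitiveIdeal_of_infinite_path (hK : E.ConditionK) {p : ℕ → Ed}
    (hp : ∀ n, E.r (p n) = E.s (p (n + 1))) {H : Set V}
    (hH : ∀ a, a ∈ H ↔ ¬ ∃ n, E.Ge a (E.s (p n))) :
    (idealHS R E H (E.B H)).IsLeftPrimitiveIdeal ∧
      (idealHS R E H (E.B H)).IsRightPrimitiveIdeal := by
  have : Nonempty (E.TailClass p) := ⟨TailClass.shift hp 0⟩
  have h1 : (TailClass.branchingSystem (E := E) p).nullSet = H :=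
    Set.ext fun a => (TailClass.mem_nullSet hp).trans (hH a).symm
  have h2 : {a | a ∈ E.B H ∧ ∀ x, (TailClass.branchingSystem (E := E) p).src x = a →
      (TailClass.branchingSystem (E := E) p).hd x ≠ none} = E.B H :=
    Set.ext fun a => and_iff_left fun x _ => Option.some_ne_none _
  have hl := isLeftPrimitiveIdeal_of_branchingSystem (R := R) hK (TailClass.separated (p := p))
    TailClass.tailConnected
  have hr := isRightPrimitiveIdeal_of_branchingSystem (R := R) hK (TailClass.separated (p := p))
    TailClass.tailConnected
  rw [h1, h2] at hl hr
  exact ⟨hl, hr⟩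

theorem isPrimitiveIdeal_of_mem_tailIdeals [Countable V] (hK : E.ConditionK)
    {I : TwoSidedIdeal (LeavittPathAlgebra R E)} (hI : I ∈ tailIdeals R E) :
    I.IsLeftPrimitiveIdeal ∧ I.IsRightPrimitiveIdeal := by
  rcases hI with ⟨M, hM, rfl⟩ | ⟨b, ⟨hinf, hb⟩, rfl⟩
  · rw [omega_compl hM.mt1]
    rcases hM.exists_path_or_vertex with ⟨p, hp, hMp⟩ | ⟨b, hb, hMb, hno⟩
    · exact isPrimitiveIdeal_of_infinite_path hK hp fun a => not_congr (hMp a)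
    -- No edge from b ends in M: by MT2 this makes b a sink or an infinite emitter, and it also
    -- excludes b from B_H.
    · refine isPrimitiveIdeal_of_vertex hK (fun hne => ?_) (fun a => not_congr (hMb a))
        fun a => (and_iff_left_of_imp ?_).symm
      · intro hfin
        obtain ⟨e, hs, hr⟩ := hM.mt2 b hb hne hfin
        exact hno e hs hr
      · rintro ⟨-, -, ⟨e, hs, hr⟩, -⟩ rfl
        exact hno e hs (not_not.1 hr)
  · refine isPrimitiveIdeal_of_vertex hK (fun _ => hinf) (fun a => ?_) fun a => Iff.rfl
    constructor
    · rintro ⟨-, h⟩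
      exact h b rfl
    · intro h
      refine ⟨?_, ?_⟩
      · rintro rfl
        exact h (Ge.refl _)
      · rintro _ rfl
        exact h

end LeavittPathAlgebra

theorem corollary6p10 {V : Type u} {Ed : Type v} [Countable V] [Countable Ed]
    (E : DirGraph V Ed) (R : Type w) [Field R] (hK : E.ConditionK) :
    {I : TwoSidedIdeal (LeavittPathAlgebra R E) | I.IsLeftPrimitiveIdeal} =
        LeavittPathAlgebra.tailIdeals R E ∧
      {I : TwoSidedIdeal (LeavittPathAlgebra R E) | I.IsRightPrimitiveIdeal} =
        LeavittPathAlgebra.tailIdeals R E ∧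
      {I : TwoSidedIdeal (LeavittPathAlgebra R E) | I.IsPrimeIdeal} =
        {I : TwoSidedIdeal (LeavittPathAlgebra R E) | I.IsLeftPrimitiveIdeal} ∧
      {I : TwoSidedIdeal (LeavittPathAlgebra R E) | I.IsPrimeIdeal} =
        {I : TwoSidedIdeal (LeavittPathAlgebra R E) | I.IsRightPrimitiveIdeal} := by
  have hP : {I : TwoSidedIdeal (LeavittPathAlgebra R E) | I.IsPrimeIdeal} =
      LeavittPathAlgebra.tailIdeals R E := Set.Subset.antisymm
    (fun I hI => LeavittPathAlgebra.mem_tailIdeals_of_isPrimeIdeal hK hI)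
    fun I hI => (LeavittPathAlgebra.isPrimitiveIdeal_of_mem_tailIdeals hK hI).1.isPrimeIdeal
  have hL : {I : TwoSidedIdeal (LeavittPathAlgebra R E) | I.IsLeftPrimitiveIdeal} =
      LeavittPathAlgebra.tailIdeals R E := Set.Subset.antisymm
    (fun I hI => hP ▸ hI.isPrimeIdeal)
    fun I hI => (LeavittPathAlgebra.isPrimitiveIdeal_of_mem_tailIdeals hK hI).1
  have hR : {I : TwoSidedIdeal (LeavittPathAlgebra R E) | I.IsRightPrimitiveIdeal} =
      LeavittPathAlgebra.tailIdeals R E := Set.Subset.antisymm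
    (fun I hI => hP ▸ hI.isPrimeIdeal)
    fun I hI => (LeavittPathAlgebra.isPrimitiveIdeal_of_mem_tailIdeals hK hI).2
  exact ⟨hL, hR, hP.trans hL.symm, hP.trans hR.symm⟩
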